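/- Let $k\ge 2$ and let $n_1,\dots,n_k$ be integers with $n_1\ge 1$, $n_k\ge 1$ and $n_i\ge 2$ for $1<i<k$; put $m_i=n_1+\dots+n_i$ and $m_0=0$. Let $\mathbb F$ be an algebraically closed field of characteristic $2$, and let $R$ be a commutative ring of characteristic $2$ with an $R$-algebra structure on $\mathbb F$ (for example $R=\mathbb Z_2$ or $R=\mathbb F$). **The dg-algebra.** Let $\Lambda=\Lambda[n_1,\dots,n_k]$ be the Legendrian $2$-bridge link whose front has four strands (numbered from the bottom) and consists, from left to right, of two left cusps joining strands $1,2$ and $3,4$; of blocks $1,\dots,k$, where block $i$ has $n_i$ crossings $a_{m_{i-1}+1},\dots,a_{m_i}$, between strands $2,3$ if $i$ is odd and between strands $1,2$ if $i$ is even; and of two right cusps $b_1,b_2$, joining strands $1,2$ and $3,4$ respectively if $k$ is odd, and strands $2,3$ (inner) and $1,4$ (outer) respectively if $k$ is even. Let $(\mathcal A,\partial)$ be the Chekanov–Eliashberg algebra of its Ng resolution (gradings ignored), with a base point $t_j$ on the loop at $b_j$, oriented counterclockwise: $\mathcal A$ is the non-commutative $R$-algebra generated by the Reeb chords $a_1,\dots,a_{m_k},b_1,b_2$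 and by $t_1^{\pm1},t_2^{\pm1}$, and $\partial$ is the derivation that vanishes on $t_j^{\pm1}$ and whose value at a Reeb chord is the sum of the words of the immersed disks with exactly one positive corner, at this chord. **Augmentations.** An augmentation is an $R$-algebra homomorphism $\varepsilon:\mathcal A\to\mathbb F$ with $\varepsilon\circ\partial=0$. Let $\widetilde{\mathrm{Aug}}$ be the set of augmentations, regarded as an affine variety through the values of $\varepsilon$ on the generators. Two augmentations $\varepsilon_1,\varepsilon_2$ are dg-algebra homotopic if there is an $R$-linear map $h:\mathcal A\to\mathbb F$ (a homotopy) such that $h(xy)=h(x)\varepsilon_2(y)+\varepsilon_1(x)h(y)$ for all $x,y\in\mathcal A$ and $\varepsilon_1(c)-\varepsilon_2(c)=h(\partial c)$ for every Reeb chord $c$. Let $\mathrm{Aug}_u(\Lambda)$ be the quotient of $\widetilde{\mathrm{Aug}}$ by homotopy. **Continuants.** Let $K_0=1$, $K_1(x_1)=x_1$ and $K_m(x_1,\dots,x_m)=x_1K_{m-1}(x_2,\dots,x_m)-K_{m-2}(x_3,\dots,x_m)$. Call $a_{m_1+1},\dots,a_{m_{k-1}+1}$ the boundary crossings. Let $V\subset\mathbb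 F^{m_k-k+1}$, with coordinates indexed by the non-boundary crossings, be given by $$K_{n_1}(a_1,\dots,a_{m_1})=0,\qquad K_{n_i-1}(a_{m_{i-1}+2},\dots,a_{m_i})=0\ (1<i<k),\qquad K_{n_k-1}(a_{m_{k-1}+2},\dots,a_{m_k})\ne0,$$ and let $V'\subset\mathbb F^{m_k-k+2}$, with the additional coordinate $a_{m_{k-1}+1}$, be given by the same equations for the blocks $i<k$ together with $K_{n_k}(a_{m_{k-1}+1},\dots,a_{m_k})=0$. **Proposition.** 1. Homotopy is an equivalence relation, and two augmentations are homotopic if and only if they agree on all non-boundary crossings. 2. Evaluation on the non-boundary crossings induces a bijection $\mathrm{Aug}_u(\Lambda)\to V$. It is an identification of varieties: a function $f:V\to\mathbb F$ is regular if and only if its pull-back to $\widetilde{\mathrm{Aug}}$ is regular. 3. There is a bijection $\mathrm{Aug}_u(\Lambda)\to V'$ whose components at the non-boundary crossings are the evaluations, and which is an identification of varieties in the same sense. 4. The equation $\partial b_2=0$ is redundant: if an $R$-algebra homomorphism $\varepsilon:\mathcal A\to\mathbb F$ satisfies $\varepsilon(\partial a_j)=0$ for all $j$ and $\varepsilon(\partial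 b_1)=0$, then $\varepsilon(\partial b_2+t_2)\neq0$, and there is a unique augmentation that agrees with $\varepsilon$ on all Reeb chords and on $t_1$. 5. The boundary crossings and $b_1,b_2$ are free: for every point of $V$ and all prescribed values in $\mathbb F$ on the boundary crossings and on $b_1,b_2$, there is a unique augmentation with these values on the Reeb chords. 6. They are killed by explicit homotopies: if $\varepsilon_1,\varepsilon_2$ agree on all non-boundary crossings, then there is a homotopy $h$ between them with $h(b_1)=h(b_2)=0$, with $h(a_j)=0$ for $j\notin\{m_1,\dots,m_{k-1}\}$, and, for $1\le i<k$, $$h(a_{m_i})=\varepsilon_1\Big(K_{n_1-1}(a_1,\dots,a_{m_1-1})\prod_{l=2}^{i}K_{n_l-2}(a_{m_{l-1}+2},\dots,a_{m_l-1})\Big)^{-1}\big(\varepsilon_1(a_{m_i+1})-\varepsilon_2(a_{m_i+1})\big),$$ where the inverted element of $\mathbb F$ is nonzero. -/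

import Mathlib

/-!
The Legendrian two-bridge link `Λ[n₁,…,n_k]` is handled through the Ng resolution of its
four-strand front.  From left to right the diagram consists of two left cusps (joining strands
1, 2 and strands 3, 4, counted from the bottom), then `k` blocks of crossings, the `i`-th block
having `n_i` crossings, between strands 2, 3 for `i` odd and between strands 1, 2 for `i` even, and
finally two right cusps, joining strands 1, 2 and 3, 4 for `k` odd, and the nested pairs 2, 3 (inner)
and 1, 4 (outer) for `k` even.  In code blocks and strands are numbered from 0.
-/

namespace TwoBridge

/-- The crossings of the front. The crossing `a_{m_{i-1}+j}`, the `j`-th crossing of the `i`-th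
block, is the pair of (zero-based) indices `⟨i - 1, j - 1⟩`. -/
abbrev Crossing {k : ℕ} (n : Fin k → ℕ) : Type := (i : Fin k) × Fin (n i)

/-- The conditions `n₁ ≥ 1`, `n_k ≥ 1` and `n_i ≥ 2` for `1 < i < k`. -/
structure IsRationalForm {k : ℕ} (n : Fin k → ℕ) : Prop where
  pos : ∀ i, 1 ≤ n i
  two_le : ∀ i : Fin k, 0 < i.val → i.val + 1 < k → 2 ≤ n i

/-- All crossings, from left to right. -/
def crossings {k : ℕ} (n : Fin k → ℕ) : List (Crossing n) :=
  (List.finRange k).flatMap fun i => (List.finRange (n i)).map fun j => ⟨i, j⟩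

/-- The crossings to the left of `c`, listed from right to left. -/
def leftOf {k : ℕ} {n : Fin k → ℕ} (c : Crossing n) : List (Crossing n) :=
  ((crossings n).takeWhile fun c' => decide (c' ≠ c)).reverse

/-- A crossing of level `s` involves the strands `s` and `s + 1` of the strands `0, 1, 2, 3`. -/
def level {k : ℕ} {n : Fin k → ℕ} (c : Crossing n) : Fin 3 :=
  if c.1.val % 2 = 0 then 1 else 0

/-- The lower of the two strand positions at a crossing. -/
def lowerStrand {k : ℕ} {n : Fin k → ℕ} (c : Crossing n) : Fin 4 := (level c).castSucc

/-- The upper of the two strand positions at a crossing. -/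
def upperStrand {k : ℕ} {n : Fin k → ℕ} (c : Crossing n) : Fin 4 := (level c).succ

/-! ### Disks

The left and right quadrants of a front crossing carry a positive Reeb sign, the top and bottom
quadrants a negative one.  An immersed disk that lies to the left of a vertical line and ends on that
line in one interval is described, slice by slice, by the strands carrying its lower and its
upper boundary.  When a boundary arc passes a crossing it either follows its strand, or it has a convex
corner there, in the top quadrant for the lower boundary and in the bottom quadrant for the upper
boundary; both of these are negative corners.  On the left the disk ends at a left cusp. -/

/-- The lower boundary of a disk, on strand `p` to the left of `c`, can be on strand `p'` to the right
of `c`: it follows its strand, or it has a negative corner in the top quadrant. -/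
def LowerStep {k : ℕ} {n : Fin k → ℕ} (c : Crossing n) (p p' : Fin 4) : Prop :=
  p' = Equiv.swap (lowerStrand c) (upperStrand c) p ∨ (p = upperStrand c ∧ p' = upperStrand c)

/-- The upper boundary of a disk, on strand `q` to the left of `c`, can be on strand `q'` to the right
of `c`: it follows its strand, or it has a negative corner in the bottom quadrant. -/
def UpperStep {k : ℕ} {n : Fin k → ℕ} (c : Crossing n) (q q' : Fin 4) : Prop :=
  q' = Equiv.swap (lowerStrand c) (upperStrand c) q ∨ (q = lowerStrand c ∧ q' = lowerStrand c)

/-- `PartialDisk n L p q`: partial disks without positive corners to the left of a vertical line, where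
`L` lists the crossings to the left of that line from right to left, and the disk meets
the line in the interval from strand `p` to strand `q`. -/
inductive PartialDisk {k : ℕ} (n : Fin k → ℕ) : List (Crossing n) → Fin 4 → Fin 4 → Type
  | bottomCusp : PartialDisk n [] 0 1
  | topCusp : PartialDisk n [] 2 3
  | step (c : Crossing n) (L : List (Crossing n)) (p q p' q' : Fin 4) (Δ : PartialDisk n L p q)
      (hp : LowerStep c p p') (hq : UpperStep c q q') (hlt : p' < q') :
      PartialDisk n (c :: L) p' q'

/-- There are finitely many disks, so that the sums over disks below are honest finite sums. -/
instance PartialDisk.finite {k : ℕ} {n : Fin k → ℕ} (L : List (Crossing n)) :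
    ∀ p q : Fin 4, Finite (PartialDisk n L p q) := by
  induction L with
  | nil =>
    intro p q
    refine Finite.of_injective (β := Unit) (fun _ => ()) ?_
    intro x y _
    cases x <;> cases y <;> rfl
  | cons c L ih =>
    intro p' q'
    refine Finite.of_injective (β := (p : Fin 4) × (q : Fin 4) × PartialDisk n L p q)
      (fun x => match x with
        | PartialDisk.step _ _ p q _ _ Δ _ _ _ => ⟨p, q, Δ⟩) ?_
    intro x y h
    cases x
    cases y
    simp only [Sigma.mk.injEq] at h
    obtain ⟨rfl, h⟩ := h
    simp only [heq_eq_eq, Sigma.mk.injEq] at h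
    obtain ⟨rfl, h⟩ := h
    simp only [heq_eq_eq] at h
    subst h
    rfl

/-! ### The Legendrian dg-algebra -/

/-- The Reeb chords: the crossings of the front, and one chord for each right cusp; `b 0` and `b 1`
stand for `b₁` and `b₂`. -/
inductive ReebChord {k : ℕ} (n : Fin k → ℕ) : Type
  | a (c : Crossing n)
  | b (j : Fin 2)

/-- The generators: Reeb chords, the base points `t₁, t₂`, and their inverses. -/
inductive Gen {k : ℕ} (n : Fin k → ℕ) : Type
  | chord (x : ReebChord n)
  | t (j : Fin 2)
  | tInv (j : Fin 2)

/-- The relations `t t⁻¹ = t⁻¹ t = 1`. -/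
inductive Rel (R : Type*) [CommRing R] {k : ℕ} (n : Fin k → ℕ) :
    FreeAlgebra R (Gen n) → FreeAlgebra R (Gen n) → Prop
  | mul_inv (j : Fin 2) :
      Rel R n (FreeAlgebra.ι R (Gen.t j) * FreeAlgebra.ι R (Gen.tInv j)) 1
  | inv_mul (j : Fin 2) :
      Rel R n (FreeAlgebra.ι R (Gen.tInv j) * FreeAlgebra.ι R (Gen.t j)) 1

/-- The underlying non-commutative algebra of the Legendrian dg-algebra `𝒜(Λ[n₁,…,n_k]; R)`. -/
abbrev LegAlg (R : Type*) [CommRing R] {k : ℕ} (n : Fin k → ℕ) : Type _ := RingQuot (Rel R n)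

section Differential

variable (R : Type*) [CommRing R] {k : ℕ} (n : Fin k → ℕ)

/-- The generators as elements of the algebra. -/
def gen (g : Gen n) : LegAlg R n := RingQuot.mkAlgHom R (Rel R n) (FreeAlgebra.ι R g)

/-- The crossing `c` as an element of the algebra. -/
def aGen (c : Crossing n) : LegAlg R n := gen R n (Gen.chord (ReebChord.a c))

/-- The chord of a right cusp as an element of the algebra. -/
def bGen (j : Fin 2) : LegAlg R n := gen R n (Gen.chord (ReebChord.b j))

/-- A base point as an element of the algebra. -/
def tGen (j : Fin 2) : LegAlg R n := gen R n (Gen.t j)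

/-- The inverse of a base point as an element of the algebra. -/
def tInvGen (j : Fin 2) : LegAlg R n := gen R n (Gen.tInv j)

variable {n} in
open Classical in
/-- The product of the negative corners of a partial disk, read counterclockwise: along the
upper boundary from right to left, then along the lower boundary from left to right. -/
noncomputable def PartialDisk.word {L : List (Crossing n)} {p q : Fin 4} :
    PartialDisk n L p q → LegAlg R n
  | PartialDisk.bottomCusp => 1
  | PartialDisk.topCusp => 1
  | PartialDisk.step c _ p q p' q' Δ _ _ _ =>
      (if q = lowerStrand c ∧ q' = lowerStrand c then aGen R n c else 1) * Δ.word *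
      (if p = upperStrand c ∧ p' = upperStrand c then aGen R n c else 1)

/-- The sum of the words of all partial disks that end in the interval from strand `p` to
strand `q`, immediately to the right of the crossings in `L`. -/
noncomputable def diskSum (L : List (Crossing n)) (p q : Fin 4) : LegAlg R n :=
  ∑ᶠ Δ : PartialDisk n L p q, Δ.word R

/-- The sum of the words of all partial disks that end to the right of all crossings of the front. -/
noncomputable def totalSum (p q : Fin 4) : LegAlg R n := diskSum R n (crossings n).reverse p q

/-- The differential on Reeb chords: the sum of the words `w(Δ)` of the immersed disks `Δ` with
exactly one positive corner, at the given chord.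

* At a front crossing the positive corner fills the left quadrant and the disk lies to its left.
  (No disk has its positive corner in the right quadrant: the rightmost point of such a disk
  would be a vertical tangency, hence lie on the loop at a right cusp, and the disk would be that
  loop.)
* At a right cusp, the loop to the right of the crossing `b_j` is a disk with word `t_j`.
* For `k` odd the other disks of `b₁`, `b₂` end in the intervals between strands 1, 2 and 3, 4.
* For `k` even the other disks of `b₁` end in the interval between strands 2, 3. The other disks
  of `b₂` end in the interval between strands 1, 4, or they go around the inner loop: then the boundary
  consists of a piece between strand 2 or 3 and strand 4, of the loop traversed clockwise, with a
  negative corner at `b₁` just before it if the boundary arrives along strand 3, and one just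
  after it if the boundary leaves along strand 2, and of a piece between strand 1 and strand 2 or 3. -/
noncomputable def dChord : ReebChord n → LegAlg R n
  | ReebChord.a c => diskSum R n (leftOf c) (lowerStrand c) (upperStrand c)
  | ReebChord.b j =>
      if k % 2 = 1 then
        (if j = 0 then totalSum R n 0 1 else totalSum R n 2 3) + tGen R n j
      else if j = 0 then totalSum R n 1 2 + tGen R n 0
      else
        totalSum R n 0 3
        + ∑ p ∈ ({1, 2} : Finset (Fin 4)), ∑ q ∈ ({1, 2} : Finset (Fin 4)),
            totalSum R n p 3 * (if p = 2 then bGen R n 0 else 1) * tInvGen R n 0 *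
              (if q = 1 then bGen R n 0 else 1) * totalSum R n 0 q
        + tGen R n 1

/-- The differential on generators; it vanishes on base points. -/
noncomputable def dGen : Gen n → LegAlg R n
  | Gen.chord x => dChord R n x
  | Gen.t _ => 0
  | Gen.tInv _ => 0

/-- The algebra homomorphism `x ↦ (x, ∂x)` to the square-zero extension of the algebra by the
bimodule given by the algebra itself. -/
noncomputable def dLift : LegAlg R n →ₐ[R] TrivSqZeroExt (LegAlg R n) (LegAlg R n) :=
  RingQuot.liftAlgHom R
    ⟨FreeAlgebra.lift R fun g =>
        (TrivSqZeroExt.inl (gen R n g) + TrivSqZeroExt.inr (dGen R n g) :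
          TrivSqZeroExt (LegAlg R n) (LegAlg R n)), by
      intro x y h
      cases h with
      | mul_inv j =>
        have e : gen R n (Gen.t j) * gen R n (Gen.tInv j) = 1 := by
          simpa [gen] using RingQuot.mkAlgHom_rel R (Rel.mul_inv (R := R) (n := n) j)
        ext <;> simp [dGen, e]
      | inv_mul j =>
        have e : gen R n (Gen.tInv j) * gen R n (Gen.t j) = 1 := by
          simpa [gen] using RingQuot.mkAlgHom_rel R (Rel.inv_mul (R := R) (n := n) j)
        ext <;> simp [dGen, e]⟩

/-- The differential `∂`, the derivation that extends its values on generators. -/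
noncomputable def d : LegAlg R n →ₗ[R] LegAlg R n where
  toFun x := (dLift R n x).snd
  map_add' x y := by simp
  map_smul' r x := by simp

theorem dLift_gen (g : Gen n) :
    dLift R n (gen R n g) = TrivSqZeroExt.inl (gen R n g) + TrivSqZeroExt.inr (dGen R n g) := by
  simp [dLift, gen]

theorem d_gen (g : Gen n) : d R n (gen R n g) = dGen R n g := by
  simp [d, dLift_gen]

theorem dLift_fst (x : LegAlg R n) : (dLift R n x).fst = x := by
  have h : (TrivSqZeroExt.fstHom R (LegAlg R n) (LegAlg R n)).comp (dLift R n) =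
      AlgHom.id R (LegAlg R n) := by
    apply RingQuot.ringQuot_ext'
    apply FreeAlgebra.hom_ext
    funext g
    simpa [gen] using congrArg TrivSqZeroExt.fst (dLift_gen R n g)
  exact DFunLike.congr_fun h x

theorem d_mul (x y : LegAlg R n) : d R n (x * y) = d R n x * y + x * d R n y := by
  have hx := dLift_fst R n x
  have hy := dLift_fst R n y
  simp only [d, LinearMap.coe_mk, AddHom.coe_mk, map_mul, TrivSqZeroExt.snd_mul, hx, hy,
    smul_eq_mul, MulOpposite.smul_eq_mul_unop, MulOpposite.unop_op]
  exact add_comm _ _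

end Differential

/-! ### Augmentations and dg-algebra homotopy -/

section Augmentations

variable (R : Type*) [CommRing R] (F : Type*) [Field F] [Algebra R F] {k : ℕ} (n : Fin k → ℕ)

/-- Ungraded augmentations `(𝒜, ∂) → (F, 0)`. -/
def Augmentation : Type _ :=
  {ε : LegAlg R n →ₐ[R] F // ∀ x, ε (d R n x) = 0}

variable {R F n}

/-- `h` is a dg-algebra homotopy between the augmentations `ε₁` and `ε₂`. -/
structure IsHomotopy (ε₁ ε₂ : Augmentation R F n) (h : LegAlg R n →ₗ[R] F) : Prop where
  leibniz : ∀ x y, h (x * y) = h x * ε₂.1 y + ε₁.1 x * h y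
  chord : ∀ x : ReebChord n,
    ε₁.1 (gen R n (Gen.chord x)) - ε₂.1 (gen R n (Gen.chord x)) =
      h (d R n (gen R n (Gen.chord x)))

variable (R F n)

/-- Two augmentations are dg-algebra homotopic. -/
def Homotopic (ε₁ ε₂ : Augmentation R F n) : Prop :=
  ∃ h : LegAlg R n →ₗ[R] F, IsHomotopy ε₁ ε₂ h

/-- The ungraded augmentation variety `Aug_u(Λ[n₁,…,n_k])` as a set. -/
def AugModuli : Type _ := Quot (Homotopic R F n)

variable {R F n}

/-- The class of an augmentation. -/
def AugModuli.mk (ε : Augmentation R F n) : AugModuli R F n := Quot.mk _ ε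

/-- The affine coordinates of an augmentation: its values on all generators. -/
def Augmentation.coord (ε : Augmentation R F n) (g : Gen n) : F := ε.1 (gen R n g)

end Augmentations

/-! ### Regular functions, continuants and the affine varieties -/

/-- A function `f` on a set `X` of points with coordinates `coord x` in the affine space `F^σ` is regular
if every point has a Zariski-open neighbourhood on which `f` is a quotient of polynomials. -/
def IsRegularFun {F : Type*} [Field F] {X σ : Type*} (coord : X → σ → F) (f : X → F) : Prop :=
  ∀ x : X, ∃ p q : MvPolynomial σ F, MvPolynomial.eval (coord x) q ≠ 0 ∧
    ∀ y : X, MvPolynomial.eval (coord y) q ≠ 0 →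
      f y = MvPolynomial.eval (coord y) p / MvPolynomial.eval (coord y) q

/-- The continuant `K_m(x₁,…,x_m)`. -/
def continuant {F : Type*} [CommRing F] : List F → F
  | [] => 1
  | [x] => x
  | x :: y :: l => x * continuant (y :: l) - continuant l

section Varieties

variable {F : Type*} [Field F] {k : ℕ} {n : Fin k → ℕ}

/-- The crossings other than the boundary crossings `a_{m_i+1}`, `1 ≤ i < k`. -/
def NonBoundary (c : Crossing n) : Prop := c.1.val = 0 ∨ c.2.val ≠ 0

/-- The crossings other than `a_{m_i+1}`, `1 ≤ i < k - 1`. -/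
def NonBoundary' (c : Crossing n) : Prop := NonBoundary c ∨ c.1.val + 1 = k

/-- All variables of the block `i`. -/
def block {S : Crossing n → Prop} (x : {c // S c} → F) (i : Fin k) (h : ∀ j, S ⟨i, j⟩) : List F :=
  List.ofFn fun j : Fin (n i) => x ⟨⟨i, j⟩, h j⟩

/-- All variables of the block `i` except the first one. -/
def rightBlock {S : Crossing n → Prop} (x : {c // S c} → F) (i : Fin k)
    (h : ∀ j : Fin (n i), j.val ≠ 0 → S ⟨i, j⟩) : List F :=
  List.ofFn fun j : Fin (n i - 1) =>
    x ⟨⟨i, ⟨j.val + 1, by omega⟩⟩, h ⟨j.val + 1, by omega⟩ (Nat.succ_ne_zero _)⟩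

variable (F n)

/-- The variety `K_{n₁} = 0`, `K_{n_i-1} = 0` on the right parts of the middle blocks, and
`K_{n_k-1} ≠ 0` on the right part of the last block. -/
def openVariety : Set ({c : Crossing n // NonBoundary c} → F) :=
  {x | (∀ (i : Fin k) (hi : i.val = 0), continuant (block x i fun _ => Or.inl hi) = 0) ∧
    (∀ i : Fin k, 0 < i.val → i.val + 1 < k →
      continuant (rightBlock x i fun _ hj => Or.inr hj) = 0) ∧
    (∀ i : Fin k, i.val + 1 = k → continuant (rightBlock x i fun _ hj => Or.inr hj) ≠ 0)}

/-- The variety `K_{n₁} = 0`, `K_{n_i-1} = 0` on the right parts of the middle blocks, and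
`K_{n_k} = 0` on the whole last block. -/
def closedVariety : Set ({c : Crossing n // NonBoundary' c} → F) :=
  {x | (∀ (i : Fin k) (hi : i.val = 0), continuant (block x i fun _ => Or.inl (Or.inl hi)) = 0) ∧
    (∀ i : Fin k, 0 < i.val → i.val + 1 < k →
      continuant (rightBlock x i fun _ hj => Or.inl (Or.inr hj)) = 0) ∧
    (∀ (i : Fin k) (hi : i.val + 1 = k), continuant (block x i fun _ => Or.inr hi) = 0)}

end Varieties

section Homotopy

variable {R : Type*} [CommRing R] {F : Type*} [Field F] [Algebra R F] {k : ℕ} {n : Fin k → ℕ}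

/-- The values of an augmentation on the crossings of block `i`. -/
def blockValues (ε : Augmentation R F n) (i : Fin k) : List F :=
  List.ofFn fun j : Fin (n i) => ε.1 (aGen R n ⟨i, j⟩)

/-- The product of `K_{n₁-1}` on the crossings of the first block other than the last one, and of
`K_{n_l-2}` on the crossings of the `l`-th block other than the first and the last one, over the
blocks `l` from the second one to the block `i` (inclusive), all evaluated at `ε`. -/
def homotopyFactor (ε : Augmentation R F n) (i : Fin k) : F :=
  ∏ l ∈ Finset.Iic i,
    if l.val = 0 then continuant (blockValues ε l).dropLast
    else continuant (blockValues ε l).tail.dropLast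

end Homotopy

end TwoBridge

open TwoBridge

/-! Write D_pq for the value of `diskSum` between strands p < q (zero-based). Inside a block, the
pair (`mainSum`, `sideSum`) obeys (u, v) ↦ (v + a u, u), so its values are continuants up to a
factor. Just after a crossing the disks between the two crossing strands disappear
(`crossingSum_succ`). Hence ∂ vanishes on every non-boundary crossing, and ∂ of the first crossing
of a later block is the `mainSum` at the end of the preceding block. A later block starts at (u, v)
= (0, s). Its first crossing sends this to (s, 0) whatever its value is, so boundary crossings drop
out of the equations, which become s K = 0 with K the continuant of the rest of the block. The
recursion matrix is invertible, so (u, v) never vanishes; as u = 0 at the end of each block but the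
last, s ≠ 0. These are the equations of V, and ∂b₁ = 0 reads t₁ = s K in the last block, which gives
the inequality.

For b₂, the disks ending on the top strand obey the same recursion, so the determinant
`map_wronskian` of the two solutions is constant in each block. It forces D₀₂ ≠ 0, D₁₃ ≠ 0 and D₂₃ =
0 at every later block (`StartsWell`), hence ∂b₂ + t₂ is a unit once the other equations hold. So t₁
and t₂ are determined by the chords, and the boundary crossings and b₁, b₂ are free.

A homotopy is a skew derivation, with arbitrary values on chords and base points. Evaluated on ∂ of
a non-boundary crossing it gives 0, so those values are invariants. Conversely, if h is supported,
among the chords, on the last crossings of the blocks other than the last, then h(∂a_{m_i+1}) is the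
single term s h(a_{m_i}), with s the nonzero product of continuants `homotopyFactor`. This can be
solved for h(a_{m_i}), and the equations at b₁, b₂ are absorbed by h(t₁), h(t₂).

Regularity descends to the quotient because the free chords can be set to 0, which gives a regular
section (`exists_regular_section`). V and V' agree because consecutive continuants have no common
zero, so K_{n_k} = 0 can be solved for the first variable of the last block. -/

namespace TwoBridge

/-! ### The free algebra, its homomorphisms and derivations -/

section Algebra

variable {R : Type*} [CommRing R] {k : ℕ} {n : Fin k → ℕ}

theorem tGen_mul_tInvGen (j : Fin 2) : tGen R n j * tInvGen R n j = 1 := by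
  simpa [gen, tGen, tInvGen] using RingQuot.mkAlgHom_rel R (Rel.mul_inv (R := R) (n := n) j)

theorem tInvGen_mul_tGen (j : Fin 2) : tInvGen R n j * tGen R n j = 1 := by
  simpa [gen, tGen, tInvGen] using RingQuot.mkAlgHom_rel R (Rel.inv_mul (R := R) (n := n) j)

theorem LegAlg.induction {P : LegAlg R n → Prop} (scalar : ∀ r : R, P (algebraMap R _ r))
    (gen : ∀ g, P (gen R n g)) (add : ∀ x y, P x → P y → P (x + y))
    (mul : ∀ x y, P x → P y → P (x * y)) (x : LegAlg R n) : P x := by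
  obtain ⟨x, rfl⟩ := RingQuot.mkAlgHom_surjective R (Rel R n) x
  induction x using FreeAlgebra.induction with
  | grade0 r => simpa using scalar r
  | grade1 g => exact gen g
  | mul x y hx hy => simpa using mul _ _ hx hy
  | add x y hx hy => simpa using add _ _ hx hy

theorem LegAlg.exists_algHom {A : Type*} [Ring A] [Algebra R A] (x : ReebChord n → A)
    (t t' : Fin 2 → A) (h₁ : ∀ j, t j * t' j = 1) (h₂ : ∀ j, t' j * t j = 1) :
    ∃ φ : LegAlg R n →ₐ[R] A, (∀ c, φ (gen R n (.chord c)) = x c) ∧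
      (∀ j, φ (tGen R n j) = t j) ∧ ∀ j, φ (tInvGen R n j) = t' j := by
  refine ⟨RingQuot.liftAlgHom R ⟨FreeAlgebra.lift R fun g => match g with
    | .chord c => x c
    | .t j => t j
    | .tInv j => t' j, ?_⟩, ?_, ?_, ?_⟩
  · intro a b h
    cases h with
    | mul_inv j => simpa using h₁ j
    | inv_mul j => simpa using h₂ j
  all_goals intro j; simp [gen, tGen, tInvGen]

theorem map_tGen_ne_zero {F : Type*} [Field F] [Algebra R F] (φ : LegAlg R n →ₐ[R] F) (j : Fin 2) :
    φ (tGen R n j) ≠ 0 := by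
  refine left_ne_zero_of_mul_eq_one (b := φ (tInvGen R n j)) ?_
  rw [← map_mul, tGen_mul_tInvGen, map_one]

theorem map_tInvGen {F : Type*} [Field F] [Algebra R F] (φ : LegAlg R n →ₐ[R] F) (j : Fin 2) :
    φ (tInvGen R n j) = (φ (tGen R n j))⁻¹ := by
  refine eq_inv_of_mul_eq_one_left ?_
  rw [← map_mul, tInvGen_mul_tGen, map_one]

/-- A homomorphism to a field is determined by its values on the chords and the base points. -/
theorem LegAlg.algHom_ext {F : Type*} [Field F] [Algebra R F] {φ ψ : LegAlg R n →ₐ[R] F}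
    (hc : ∀ c, φ (gen R n (.chord c)) = ψ (gen R n (.chord c)))
    (ht : ∀ j, φ (tGen R n j) = ψ (tGen R n j)) : φ = ψ := by
  refine AlgHom.ext fun x => ?_
  induction x using LegAlg.induction with
  | scalar r => simp
  | gen g =>
    cases g with
    | chord c => exact hc c
    | t j => exact ht j
    | tInv j =>
      change φ (tInvGen R n j) = ψ (tInvGen R n j)
      rw [map_tInvGen, map_tInvGen, ht]
  | add x y hx hy => rw [map_add, map_add, hx, hy]
  | mul x y hx hy => rw [map_mul, map_mul, hx, hy]

theorem map_d_eq_zero {F : Type*} [Field F] [Algebra R F] {φ : LegAlg R n →ₐ[R] F}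
    (h : ∀ c, φ (dChord R n c) = 0) (x : LegAlg R n) : φ (d R n x) = 0 := by
  induction x using LegAlg.induction with
  | scalar r =>
    have h1 : d R n 1 = 0 := by simpa using d_mul R n 1 1
    rw [Algebra.algebraMap_eq_smul_one, map_smul, h1, smul_zero, map_zero]
  | gen g =>
    rw [d_gen]
    cases g with
    | chord c => exact h c
    | t j => exact map_zero φ
    | tInv j => exact map_zero φ
  | add x y hx hy => rw [map_add, map_add, hx, hy, add_zero]
  | mul x y hx hy => rw [d_mul, map_add, map_mul, map_mul, hx, hy, zero_mul, mul_zero, add_zero]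

/-- `h` is a derivation to the bimodule `F`, on which the algebra acts by `φ` and by `ψ`. -/
def IsSkewDerivation {F : Type*} [Field F] [Algebra R F] (φ ψ : LegAlg R n →ₐ[R] F)
    (h : LegAlg R n →ₗ[R] F) : Prop :=
  ∀ x y, h (x * y) = h x * ψ y + φ x * h y

namespace IsSkewDerivation

variable {F : Type*} [Field F] [Algebra R F] {φ ψ : LegAlg R n →ₐ[R] F}
  {h h' : LegAlg R n →ₗ[R] F}

theorem map_one (H : IsSkewDerivation φ ψ h) : h 1 = 0 := by simpa using H 1 1

theorem map_tInvGen (H : IsSkewDerivation φ ψ h) (j : Fin 2) :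
    h (tInvGen R n j) = -((ψ (tGen R n j))⁻¹ * φ (tInvGen R n j) * h (tGen R n j)) := by
  have e := H (tInvGen R n j) (tGen R n j)
  rw [tInvGen_mul_tGen, H.map_one] at e
  have := map_tGen_ne_zero ψ j
  field_simp
  linear_combination -e

/-- This allows h(t₁) and then h(t₂) to be chosen one after the other, without disturbing values
already computed on words that do not involve them. -/
theorem eqOn_adjoin (H : IsSkewDerivation φ ψ h) (H' : IsSkewDerivation φ ψ h')
    {S : Set (LegAlg R n)} (hS : ∀ x ∈ S, h x = h' x) {x : LegAlg R n}
    (hx : x ∈ Algebra.adjoin R S) : h x = h' x := by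
  induction hx using Algebra.adjoin_induction with
  | mem x hx => exact hS x hx
  | algebraMap r =>
    rw [Algebra.algebraMap_eq_smul_one, map_smul, map_smul, H.map_one, H'.map_one]
  | add x y _ _ hx hy => rw [map_add, map_add, hx, hy]
  | mul x y _ _ hx hy => rw [H, H', hx, hy]

variable (φ ψ) in
-- Skew derivations are the upper right entries of homomorphisms to upper triangular 2 × 2 matrices
-- with diagonal (φ, ψ). Such a homomorphism is prescribed freely on chords and base points, and the
-- entry at t⁻¹ is that of the inverse matrix.
theorem exists_of_values (x : ReebChord n → F) (t : Fin 2 → F) :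
    ∃ h, IsSkewDerivation φ ψ h ∧ (∀ c, h (gen R n (.chord c)) = x c) ∧
      ∀ j, h (tGen R n j) = t j := by
  obtain ⟨χ, hc, ht, ht'⟩ := LegAlg.exists_algHom (R := R) (n := n)
    (A := Matrix (Fin 2) (Fin 2) F)
    (fun c => !![φ (gen R n (.chord c)), x c; 0, ψ (gen R n (.chord c))])
    (fun j => !![φ (tGen R n j), t j; 0, ψ (tGen R n j)])
    (fun j => !![φ (tInvGen R n j), -(φ (tInvGen R n j) * t j * ψ (tInvGen R n j)); 0,
      ψ (tInvGen R n j)]) (fun j => by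
        have := map_tGen_ne_zero φ j
        have := map_tGen_ne_zero ψ j
        rw [TwoBridge.map_tInvGen, TwoBridge.map_tInvGen]
        ext a b
        fin_cases a <;> fin_cases b <;> simp [Matrix.mul_apply, Fin.sum_univ_two] <;> field_simp
        ring) (fun j => by
        have := map_tGen_ne_zero φ j
        have := map_tGen_ne_zero ψ j
        rw [TwoBridge.map_tInvGen, TwoBridge.map_tInvGen]
        ext a b
        fin_cases a <;> fin_cases b <;> simp [Matrix.mul_apply, Fin.sum_univ_two] <;> field_simp
        ring)
  have key : ∀ y, χ y 0 0 = φ y ∧ χ y 1 0 = 0 ∧ χ y 1 1 = ψ y := by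
    intro y
    induction y using LegAlg.induction with
    | scalar r => simp [Matrix.algebraMap_matrix_apply]
    | gen g =>
      cases g with
      | chord c => simp [hc]
      | t j =>
        change χ (tGen R n j) 0 0 = φ (tGen R n j) ∧ χ (tGen R n j) 1 0 = 0 ∧
          χ (tGen R n j) 1 1 = ψ (tGen R n j)
        simp [ht]
      | tInv j =>
        change χ (tInvGen R n j) 0 0 = φ (tInvGen R n j) ∧ χ (tInvGen R n j) 1 0 = 0 ∧
          χ (tInvGen R n j) 1 1 = ψ (tInvGen R n j)
        simp [ht']
    | add y z hy hz => simp [hy, hz]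
    | mul y z hy hz => simp [Matrix.mul_apply, Fin.sum_univ_two, hy, hz]
  refine ⟨{ toFun := fun y => χ y 0 1, map_add' := fun y z => by simp,
            map_smul' := fun r y => by simp }, ?_, ?_, ?_⟩
  · intro y z
    simp only [LinearMap.coe_mk, AddHom.coe_mk, map_mul, Matrix.mul_apply, Fin.sum_univ_two,
      (key y).1, (key z).2.2]
    ring
  · intro c
    simp [hc]
  · intro j
    simp [ht]

end IsSkewDerivation

end Algebra

/-! ### Recursion for the sums over partial disks -/

section Disks

variable (R : Type*) [CommRing R] {k : ℕ} {n : Fin k → ℕ}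

theorem PartialDisk.lt {L : List (Crossing n)} {p q : Fin 4} (Δ : PartialDisk n L p q) : p < q := by
  cases Δ with
  | bottomCusp => decide
  | topCusp => decide
  | step _ _ _ _ _ _ _ _ _ h => exact h

theorem diskSum_of_not_lt (L : List (Crossing n)) {p q : Fin 4} (h : ¬ p < q) :
    diskSum R n L p q = 0 := by
  have : IsEmpty (PartialDisk n L p q) := ⟨fun Δ => h Δ.lt⟩
  exact finsum_of_isEmpty _

theorem diskSum_mem_adjoin (L : List (Crossing n)) (p q : Fin 4) :
    diskSum R n L p q ∈ Algebra.adjoin R (Set.range (aGen R n)) := by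
  have hw : ∀ {L : List (Crossing n)} {p q : Fin 4} (Δ : PartialDisk n L p q),
      Δ.word R ∈ Algebra.adjoin R (Set.range (aGen R n)) := by
    intro L p q Δ
    induction Δ with
    | bottomCusp => exact one_mem _
    | topCusp => exact one_mem _
    | step c L p q p' q' Δ hp hq hlt ih =>
      have hc : aGen R n c ∈ Algebra.adjoin R (Set.range (aGen R n)) :=
        Algebra.subset_adjoin ⟨c, rfl⟩
      refine mul_mem (mul_mem ?_ ih) ?_
      all_goals split_ifs
      exacts [hc, one_mem _, hc, one_mem _]
  exact finsum_induction _ (zero_mem _) (fun _ _ => add_mem) fun Δ => hw Δ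

theorem diskSum_nil_cusp : diskSum R n [] 0 1 = 1 ∧ diskSum R n [] 2 3 = 1 := by
  constructor
  · let : Unique (PartialDisk n [] 0 1) :=
      { default := .bottomCusp, uniq := fun Δ => by cases Δ; rfl }
    rw [diskSum, finsum_unique]
    rfl
  · let : Unique (PartialDisk n [] 2 3) :=
      { default := .topCusp, uniq := fun Δ => by cases Δ; rfl }
    rw [diskSum, finsum_unique]
    rfl

theorem diskSum_nil_zero {p q : Fin 4} (h₁ : ¬ (p = 0 ∧ q = 1)) (h₂ : ¬ (p = 2 ∧ q = 3)) :
    diskSum R n [] p q = 0 := by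
  have : IsEmpty (PartialDisk n [] p q) := by
    refine ⟨fun Δ => ?_⟩
    cases Δ with
    | bottomCusp => exact h₁ ⟨rfl, rfl⟩
    | topCusp => exact h₂ ⟨rfl, rfl⟩
  exact finsum_of_isEmpty _

/-- The partial disks just behind a crossing. -/
def PartialDisk.consEquiv (c : Crossing n) (L : List (Crossing n)) {p' q' : Fin 4} (hlt : p' < q') :
    PartialDisk n (c :: L) p' q' ≃
      {x : (p : Fin 4) × (q : Fin 4) × PartialDisk n L p q //
        LowerStep c x.1 p' ∧ UpperStep c x.2.1 q'} where
  toFun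
    | .step _ _ p q _ _ Δ hp hq _ => ⟨⟨p, q, Δ⟩, hp, hq⟩
  invFun x := .step c L x.1.1 x.1.2.1 p' q' x.1.2.2 x.2.1 x.2.2 hlt
  left_inv Δ := by cases Δ; rfl
  right_inv x := rfl

open Classical in
-- A partial disk behind `c` is a partial disk in front of `c` together with its last step; the
-- boundary strands after the step decide whether there is a corner at `c`.
theorem diskSum_cons (c : Crossing n) (L : List (Crossing n)) {p' q' : Fin 4} (hlt : p' < q') :
    diskSum R n (c :: L) p' q' = ∑ p, ∑ q, if LowerStep c p p' ∧ UpperStep c q q' then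
      (if q = lowerStrand c ∧ q' = lowerStrand c then aGen R n c else 1) * diskSum R n L p q *
      (if p = upperStrand c ∧ p' = upperStrand c then aGen R n c else 1) else 0 := by
  have : ∀ p q : Fin 4, Fintype (PartialDisk n L p q) := fun p q => Fintype.ofFinite _
  have e := finsum_comp_equiv (PartialDisk.consEquiv c L hlt).symm
    (f := fun Δ => PartialDisk.word R Δ)
  rw [diskSum, ← e, finsum_eq_sum_of_fintype]
  let f : ((p : Fin 4) × (q : Fin 4) × PartialDisk n L p q) → LegAlg R n := fun x =>
    (if x.2.1 = lowerStrand c ∧ q' = lowerStrand c then aGen R n c else 1) * x.2.2.word R *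
      (if x.1 = upperStrand c ∧ p' = upperStrand c then aGen R n c else 1)
  change ∑ x : {x : (p : Fin 4) × (q : Fin 4) × PartialDisk n L p q //
        LowerStep c x.1 p' ∧ UpperStep c x.2.1 q'}, f x.1 = _
  rw [← Finset.sum_subtype (p := fun x => LowerStep c x.1 p' ∧ UpperStep c x.2.1 q')
    (Finset.univ.filter fun x => LowerStep c x.1 p' ∧ UpperStep c x.2.1 q') (by simp) f,
    Finset.sum_filter, Fintype.sum_sigma]
  refine Finset.sum_congr rfl fun p _ => ?_
  rw [Fintype.sum_sigma]
  refine Finset.sum_congr rfl fun q _ => ?_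
  by_cases h : LowerStep c p p' ∧ UpperStep c q q'
  · simp only [h, diskSum, finsum_eq_sum_of_fintype, f, Finset.mul_sum, Finset.sum_mul]
    simp
  · simp [h]

theorem diskSum_cons_one {c : Crossing n} (hc : level c = 1) (L : List (Crossing n)) :
    diskSum R n (c :: L) 0 1 = diskSum R n L 0 2 + aGen R n c * diskSum R n L 0 1 ∧
    diskSum R n (c :: L) 0 2 = diskSum R n L 0 1 ∧
    diskSum R n (c :: L) 0 3 = diskSum R n L 0 3 ∧
    diskSum R n (c :: L) 1 2 = 0 ∧
    diskSum R n (c :: L) 1 3 = diskSum R n L 2 3 ∧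
    diskSum R n (c :: L) 2 3 = diskSum R n L 1 3 + diskSum R n L 2 3 * aGen R n c := by
  have hl : lowerStrand c = 1 := by rw [lowerStrand, hc]; rfl
  have hu : upperStrand c = 2 := by rw [upperStrand, hc]; rfl
  have h21 : diskSum R n L 2 1 = 0 := diskSum_of_not_lt R L (by decide)
  refine ⟨?_, ?_, ?_, ?_, ?_, ?_⟩ <;> rw [diskSum_cons R c L (by decide)] <;>
    simp [Fin.sum_univ_four, LowerStep, UpperStep, hl, hu, Equiv.swap_apply_def, h21, add_comm]

theorem diskSum_cons_zero {c : Crossing n} (hc : level c = 0) (L : List (Crossing n)) :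
    diskSum R n (c :: L) 0 1 = 0 ∧
    diskSum R n (c :: L) 0 2 = diskSum R n L 1 2 ∧
    diskSum R n (c :: L) 0 3 = diskSum R n L 1 3 ∧
    diskSum R n (c :: L) 1 2 = diskSum R n L 0 2 + diskSum R n L 1 2 * aGen R n c ∧
    diskSum R n (c :: L) 1 3 = diskSum R n L 0 3 + diskSum R n L 1 3 * aGen R n c ∧
    diskSum R n (c :: L) 2 3 = diskSum R n L 2 3 := by
  have hl : lowerStrand c = 0 := by rw [lowerStrand, hc]; rfl
  have hu : upperStrand c = 1 := by rw [upperStrand, hc]; rfl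
  have h10 : diskSum R n L 1 0 = 0 := diskSum_of_not_lt R L (by decide)
  refine ⟨?_, ?_, ?_, ?_, ?_, ?_⟩ <;> rw [diskSum_cons R c L (by decide)] <;>
    simp [Fin.sum_univ_four, LowerStep, UpperStep, hl, hu, Equiv.swap_apply_def, h10, add_comm]

end Disks

/-! ### The crossings to the left of a crossing -/

section Order

variable {k : ℕ} {n : Fin k → ℕ}

variable (n) in
/-- The crossings to the left of the `j`-th crossing of block `i`, listed from right to left. -/
def before (i : Fin k) (j : ℕ) : List (Crossing n) :=
  (((List.finRange k).take i).flatMap (fun i =>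
      (List.finRange (n i)).map fun j => (⟨i, j⟩ : Crossing n)) ++
    ((List.finRange (n i)).take j).map fun j => (⟨i, j⟩ : Crossing n)).reverse

theorem before_succ (i : Fin k) (j : Fin (n i)) :
    before n i (j + 1) = ⟨i, j⟩ :: before n i j := by
  have : (List.finRange (n i)).take (j + 1) = (List.finRange (n i)).take j ++ [j] := by
    rw [List.take_add_one]
    simp
  simp [before, this]

theorem before_zero_zero (i : Fin k) (hi : i.val = 0) : before n i 0 = [] := by
  simp [before, hi]

theorem before_next (i i' : Fin k) (h : i'.val = i.val + 1) :
    before n i' 0 = before n i (n i) := by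
  have : (List.finRange k).take (i + 1) = (List.finRange k).take i ++ [i] := by
    rw [List.take_add_one]
    simp
  simp [before, h, this, List.take_of_length_le]

theorem crossings_reverse (i : Fin k) (h : i.val + 1 = k) :
    (crossings n).reverse = before n i (n i) := by
  have : List.finRange k = (List.finRange k).take i ++ [i] := by
    conv_lhs => rw [← List.take_of_length_le (l := List.finRange k) (i := i + 1) (by simp [h]),
      List.take_add_one]
    simp
  rw [crossings, this]
  simp [before, List.take_of_length_le]

/-- The list of crossings has no repetitions, so `takeWhile` stops exactly at the given crossing. -/
theorem leftOf_eq (c : Crossing n) : leftOf c = before n c.1 c.2 := by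
  obtain ⟨i, j⟩ := c
  have hk : List.finRange k = (List.finRange k).take i ++ i :: (List.finRange k).drop (i + 1) := by
    conv_lhs => rw [← List.take_append_drop i (List.finRange k), List.drop_eq_getElem_cons (by simp)]
    simp
  have hi : List.finRange (n i) =
      (List.finRange (n i)).take j ++ j :: (List.finRange (n i)).drop (j + 1) := by
    conv_lhs =>
      rw [← List.take_append_drop j (List.finRange (n i)), List.drop_eq_getElem_cons (by simp)]
    simp
  have hki := hk ▸ List.nodup_finRange k
  have hij := hi ▸ List.nodup_finRange (n i)
  have hi' : i ∉ (List.finRange k).take i := by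
    intro h
    exact (List.nodup_append.1 hki).2.2 _ h _ (by simp) rfl
  have hj' : j ∉ (List.finRange (n i)).take j := by
    intro h
    exact (List.nodup_append.1 hij).2.2 _ h _ (by simp) rfl
  rw [leftOf, before, crossings]
  congr 1
  conv_lhs => rw [hk]
  rw [List.flatMap_append, List.flatMap_cons]
  conv_lhs => rw [hi]
  rw [List.map_append, List.map_cons, List.append_assoc, ← List.append_assoc,
    List.takeWhile_append_of_pos, List.cons_append, List.takeWhile_cons_of_neg (by simp),
    List.append_nil]
  intro c hc
  simp only [List.mem_append, List.mem_flatMap, List.mem_map] at hc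
  simp only [decide_eq_true_eq]
  rintro rfl
  rcases hc with ⟨i', hi'', j', -, h⟩ | ⟨j', hj'', h⟩
  · cases h
    exact hi' hi''
  · cases h
    exact hj' hj''

end Order

/-! ### Continuants -/

section Continuant

theorem tail_ofFn_eq {α : Type*} {m : ℕ} (f : Fin m → α) :
    (List.ofFn f).tail = List.ofFn fun j : Fin (m - 1) => f ⟨j + 1, by omega⟩ := by
  cases m with
  | zero => simp
  | succ m => rw [List.ofFn_succ]; rfl

variable {F : Type*} [CommRing F]

/-- Continuants expand at either end. The definition peels off the first entry, whereas the disk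
sums acquire new crossings on the right. -/
theorem continuant_append_pair (l : List F) (y x : F) :
    continuant (l ++ [y, x]) = x * continuant (l ++ [y]) - continuant l := by
  induction l using continuant.induct with
  | case1 => simp [continuant, mul_comm]
  | case2 z => simp [continuant]; ring
  | case3 z w l ih₁ ih₂ =>
    simp only [List.cons_append, continuant] at ih₁ ih₂ ⊢
    rw [ih₁, ih₂]
    ring

theorem continuant_concat {l : List F} (hl : l ≠ []) (x : F) :
    continuant (l ++ [x]) = x * continuant l - continuant l.dropLast := by
  obtain ⟨l, y, rfl⟩ := (List.eq_nil_or_concat l).resolve_left hl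
  simpa using continuant_append_pair l y x

/-- The two-term recursion of the disk sums, up to a sign that is invisible in characteristic 2. -/
theorem continuant_of_recursion [CharP F 2] {u v : ℕ → F} {s : F} {N : ℕ} (x : Fin N → F)
    (hu₀ : u 0 = s) (hv₀ : v 0 = 0) (hv : ∀ j : Fin N, v (j + 1) = u j)
    (hu : ∀ j : Fin N, u (j + 1) = v j + x j * u j) :
    u N = s * continuant (List.ofFn x) ∧
      (1 ≤ N → v N = s * continuant (List.ofFn x).dropLast) := by
  induction N with
  | zero => simpa [continuant] using hu₀
  | succ N ih =>
    obtain ⟨ihu, ihv⟩ := ih (fun j => x j.castSucc) (fun j => hv j.castSucc) fun j => hu j.castSucc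
    have hu' := hu (Fin.last N)
    have hv' := hv (Fin.last N)
    simp only [Fin.val_last] at hu' hv'
    rw [List.ofFn_succ', List.concat_eq_append, List.dropLast_concat]
    refine ⟨?_, fun _ => hv'.trans ihu⟩
    -- The formula for `v` is unavailable at length 0: `[].dropLast = []` has continuant 1, while `v
    -- 0 = 0`.
    rcases Nat.eq_zero_or_pos N with rfl | hN
    · simp [hu', hu₀, hv₀, continuant, mul_comm]
    · have hne : List.ofFn (fun j : Fin N => x j.castSucc) ≠ [] := by
        simpa [List.ofFn_eq_nil_iff] using hN.ne'
      rw [hu', ihu, ihv hN, continuant_concat hne, CharTwo.sub_eq_add]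
      ring

end Continuant

/-! ### The disk sums that enter the differential -/

section Sums

variable (R : Type*) [CommRing R] {k : ℕ} (n : Fin k → ℕ)

/-- The disks after `j` crossings of block `i` between the strands 0, 1 for even `i` and between the
strands 1, 2 for odd `i` (both counted from 0); at the next crossing of the block, one of their two
boundary strands crosses the strand outside the disk. -/
noncomputable def mainSum (i : Fin k) (j : ℕ) : LegAlg R n :=
  if i.val % 2 = 0 then diskSum R n (before n i j) 0 1 else diskSum R n (before n i j) 1 2

/-- The disks between strands 0 and 2 after `j` crossings of block `i`. -/
noncomputable def sideSum (i : Fin k) (j : ℕ) : LegAlg R n := diskSum R n (before n i j) 0 2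

/-- The disks between the two strands that cross in block `i`, after `j` crossings. -/
noncomputable def crossingSum (i : Fin k) (j : ℕ) : LegAlg R n :=
  if i.val % 2 = 0 then diskSum R n (before n i j) 1 2 else diskSum R n (before n i j) 0 1

/-- The counterpart of `mainSum` for the disks that end on the top strand. -/
noncomputable def topMainSum (i : Fin k) (j : ℕ) : LegAlg R n :=
  if i.val % 2 = 0 then diskSum R n (before n i j) 2 3 else diskSum R n (before n i j) 1 3

/-- The counterpart of `sideSum` for the disks that end on the top strand. -/
noncomputable def topSideSum (i : Fin k) (j : ℕ) : LegAlg R n :=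
  if i.val % 2 = 0 then diskSum R n (before n i j) 1 3 else diskSum R n (before n i j) 0 3

variable {n}

theorem level_even {i : Fin k} (h : i.val % 2 = 0) (j : Fin (n i)) :
    level (⟨i, j⟩ : Crossing n) = 1 := if_pos h

theorem level_odd {i : Fin k} (h : ¬ i.val % 2 = 0) (j : Fin (n i)) :
    level (⟨i, j⟩ : Crossing n) = 0 := if_neg h

/-- The side of the new letter depends on parity: a corner on the upper boundary is read first, one
on the lower boundary last. In `topMainSum_succ` the corner is always on the lower boundary. -/
theorem mainSum_succ (i : Fin k) (j : Fin (n i)) :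
    mainSum R n i (j + 1) = sideSum R n i j +
      if i.val % 2 = 0 then aGen R n ⟨i, j⟩ * mainSum R n i j
      else mainSum R n i j * aGen R n ⟨i, j⟩ := by
  unfold mainSum sideSum
  rw [before_succ]
  split_ifs with h
  · exact (diskSum_cons_one R (level_even h j) _).1
  · exact (diskSum_cons_zero R (level_odd h j) _).2.2.2.1

theorem sideSum_succ (i : Fin k) (j : Fin (n i)) :
    sideSum R n i (j + 1) = mainSum R n i j := by
  unfold mainSum sideSum
  rw [before_succ]
  split_ifs with h
  · exact (diskSum_cons_one R (level_even h j) _).2.1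
  · exact (diskSum_cons_zero R (level_odd h j) _).2.1

/-- Neither boundary can have just turned at the crossing, so such a disk would come from one with
its lower and upper strands interchanged. -/
theorem crossingSum_succ (i : Fin k) (j : Fin (n i)) : crossingSum R n i (j + 1) = 0 := by
  unfold crossingSum
  rw [before_succ]
  split_ifs with h
  · exact (diskSum_cons_one R (level_even h j) _).2.2.2.1
  · exact (diskSum_cons_zero R (level_odd h j) _).1

theorem topMainSum_succ (i : Fin k) (j : Fin (n i)) :
    topMainSum R n i (j + 1) = topSideSum R n i j + topMainSum R n i j * aGen R n ⟨i, j⟩ := by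
  unfold topMainSum topSideSum
  rw [before_succ]
  split_ifs with h
  · exact (diskSum_cons_one R (level_even h j) _).2.2.2.2.2
  · exact (diskSum_cons_zero R (level_odd h j) _).2.2.2.2.1

theorem topSideSum_succ (i : Fin k) (j : Fin (n i)) :
    topSideSum R n i (j + 1) = topMainSum R n i j := by
  unfold topMainSum topSideSum
  rw [before_succ]
  split_ifs with h
  · exact (diskSum_cons_one R (level_even h j) _).2.2.2.2.1
  · exact (diskSum_cons_zero R (level_odd h j) _).2.2.1

theorem diskSum_odd_succ {i : Fin k} (h : ¬ i.val % 2 = 0) (j : Fin (n i)) :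
    diskSum R n (before n i (j + 1)) 2 3 = diskSum R n (before n i j) 2 3 := by
  rw [before_succ]
  exact (diskSum_cons_zero R (level_odd h j) _).2.2.2.2.2

theorem crossingSum_end {i : Fin k} (h : 1 ≤ n i) : crossingSum R n i (n i) = 0 := by
  have := crossingSum_succ R i (⟨n i - 1, by omega⟩ : Fin (n i))
  rwa [Nat.sub_add_cancel h] at this

/-- The parity changes between blocks, which exchanges the roles of D₀₁ and D₁₂, while D₀₂ is the
side sum for both parities. -/
theorem next_block {i i' : Fin k} (h : i'.val = i.val + 1) :
    mainSum R n i' 0 = crossingSum R n i (n i) ∧ crossingSum R n i' 0 = mainSum R n i (n i) ∧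
      sideSum R n i' 0 = sideSum R n i (n i) := by
  unfold mainSum crossingSum sideSum
  rw [before_next i i' h, h]
  rcases Nat.mod_two_eq_zero_or_one i.val with h' | h' <;> simp [h', Nat.add_mod]

theorem first_block {i : Fin k} (h : i.val = 0) :
    mainSum R n i 0 = 1 ∧ crossingSum R n i 0 = 0 ∧ sideSum R n i 0 = 0 ∧
      topMainSum R n i 0 = 1 ∧ topSideSum R n i 0 = 0 := by
  unfold mainSum crossingSum sideSum topMainSum topSideSum
  rw [before_zero_zero i h]
  simp [h, diskSum_nil_cusp, diskSum_nil_zero]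

theorem exists_prev {i : Fin k} (hi : 0 < i.val) : ∃ i₀ : Fin k, i.val = i₀.val + 1 :=
  ⟨⟨i.val - 1, by omega⟩, by simp; omega⟩

theorem mainSum_start (hn : IsRationalForm n) {i : Fin k} (hi : 0 < i.val) :
    mainSum R n i 0 = 0 := by
  obtain ⟨i₀, h⟩ := exists_prev hi
  rw [(next_block R h).1, crossingSum_end R (hn.pos i₀)]

theorem d_aGen (c : Crossing n) : d R n (aGen R n c) = crossingSum R n c.1 c.2 := by
  obtain ⟨i, j⟩ := c
  rw [aGen, d_gen, dGen, dChord, leftOf_eq, crossingSum, lowerStrand, upperStrand, level]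
  dsimp only
  split_ifs <;> rfl

theorem d_aGen_nonBoundary {c : Crossing n} (hc : NonBoundary c) : d R n (aGen R n c) = 0 := by
  obtain ⟨i, j, hj⟩ := c
  rw [d_aGen]
  cases j with
  | zero => exact (first_block R (hc.resolve_right (by simp))).2.1
  | succ j => exact crossingSum_succ R i ⟨j, by omega⟩

variable (n)

/-- The differential of the chord of a right cusp, without the loop. -/
noncomputable def cuspSum (j : Fin 2) : LegAlg R n :=
  if k % 2 = 1 then
    (if j = 0 then totalSum R n 0 1 else totalSum R n 2 3)
  else if j = 0 then totalSum R n 1 2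
  else
    totalSum R n 0 3
    + ∑ p ∈ ({1, 2} : Finset (Fin 4)), ∑ q ∈ ({1, 2} : Finset (Fin 4)),
        totalSum R n p 3 * (if p = 2 then bGen R n 0 else 1) * tInvGen R n 0 *
          (if q = 1 then bGen R n 0 else 1) * totalSum R n 0 q

theorem dChord_b (j : Fin 2) : dChord R n (.b j) = cuspSum R n j + tGen R n j := by
  rw [dChord, cuspSum]
  split_ifs with h₁ h₂ h₂
  · rfl
  · rfl
  · rw [h₂]
  · rw [show j = 1 by omega]

theorem d_bGen (j : Fin 2) : d R n (bGen R n j) = cuspSum R n j + tGen R n j := by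
  rw [bGen, d_gen, dGen, dChord_b]

theorem cuspSum_zero_eq (i : Fin k) (hi : i.val + 1 = k) :
    cuspSum R n 0 = mainSum R n i (n i) := by
  unfold cuspSum mainSum totalSum
  rw [crossings_reverse i hi]
  rcases Nat.mod_two_eq_zero_or_one i.val with h | h
  · simp [h, show k % 2 = 1 by omega]
  · simp [h, show ¬ k % 2 = 1 by omega]

theorem cuspSum_zero_mem : cuspSum R n 0 ∈ Algebra.adjoin R (Set.range (aGen R n)) := by
  unfold cuspSum totalSum
  split_ifs
  exacts [diskSum_mem_adjoin R _ _ _, absurd rfl ‹_›, diskSum_mem_adjoin R _ _ _, absurd rfl ‹_›]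

/-- With `cuspSum_zero_mem` this makes the equations at b₁, b₂ triangular: t₁ is determined by the
crossings, then t₂ by the crossings, b₁ and t₁. -/
theorem cuspSum_one_mem :
    cuspSum R n 1 ∈ Algebra.adjoin R (Set.range (aGen R n) ∪ {bGen R n 0, tInvGen R n 0}) := by
  have hD (p q : Fin 4) : totalSum R n p q ∈
      Algebra.adjoin R (Set.range (aGen R n) ∪ {bGen R n 0, tInvGen R n 0}) :=
    Algebra.adjoin_mono Set.subset_union_left (diskSum_mem_adjoin R _ p q)
  have hb : bGen R n 0 ∈
      Algebra.adjoin R (Set.range (aGen R n) ∪ {bGen R n 0, tInvGen R n 0}) :=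
    Algebra.subset_adjoin (by simp)
  have ht : tInvGen R n 0 ∈
      Algebra.adjoin R (Set.range (aGen R n) ∪ {bGen R n 0, tInvGen R n 0}) :=
    Algebra.subset_adjoin (by simp)
  unfold cuspSum
  split_ifs with h₁ h₂ h₂
  · exact hD _ _
  · exact hD _ _
  · exact hD _ _
  · refine add_mem (hD _ _) (sum_mem fun p _ => sum_mem fun q _ => ?_)
    refine mul_mem (mul_mem (mul_mem (mul_mem (hD _ _) ?_) ht) ?_) (hD _ _)
    all_goals split_ifs
    exacts [hb, one_mem _, hb, one_mem _]

end Sums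

/-! ### The values of the disk sums -/

section Values

variable {R : Type*} [CommRing R] {F : Type*} [Field F] [Algebra R F] {k : ℕ} {n : Fin k → ℕ}
  (φ : LegAlg R n →ₐ[R] F)

theorem map_mainSum_succ (i : Fin k) (j : Fin (n i)) :
    φ (mainSum R n i (j + 1)) =
      φ (sideSum R n i j) + φ (aGen R n ⟨i, j⟩) * φ (mainSum R n i j) := by
  rw [mainSum_succ, map_add]
  split_ifs
  · rw [map_mul]
  · rw [map_mul, mul_comm]

theorem map_sums_first [CharP F 2] {i : Fin k} (hi : i.val = 0) :
    φ (mainSum R n i (n i)) = continuant (List.ofFn fun j => φ (aGen R n ⟨i, j⟩)) ∧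
      (1 ≤ n i →
        φ (sideSum R n i (n i)) = continuant (List.ofFn fun j => φ (aGen R n ⟨i, j⟩)).dropLast) := by
  have h := first_block R (n := n) hi
  simpa using continuant_of_recursion (u := fun j => φ (mainSum R n i j))
    (v := fun j => φ (sideSum R n i j)) (s := 1) (fun j => φ (aGen R n ⟨i, j⟩))
    (by simp [h.1]) (by simp [h.2.2.1]) (fun j => by simp only [sideSum_succ])
    fun j => map_mainSum_succ φ i j

/-- The block starts at (0, s) and its first crossing gives (s, 0) independently of its value. The
continuant recursion therefore runs over the tail only. -/
theorem map_sums_right [CharP F 2] (hn : IsRationalForm n) {i : Fin k} (hi : 0 < i.val) :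
    φ (mainSum R n i (n i)) = φ (sideSum R n i 0) *
        continuant (List.ofFn fun j => φ (aGen R n ⟨i, j⟩)).tail ∧
      (2 ≤ n i → φ (sideSum R n i (n i)) = φ (sideSum R n i 0) *
        continuant (List.ofFn fun j => φ (aGen R n ⟨i, j⟩)).tail.dropLast) := by
  have h0 := mainSum_start R hn hi
  have hpos := hn.pos i
  have hm := map_mainSum_succ φ i ⟨0, hpos⟩
  have hs := sideSum_succ R i ⟨0, hpos⟩
  simp only [zero_add, h0, map_zero, mul_zero, add_zero] at hm hs
  have := continuant_of_recursion (u := fun j => φ (mainSum R n i (j + 1)))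
    (v := fun j => φ (sideSum R n i (j + 1))) (N := n i - 1) (s := φ (sideSum R n i 0))
    (fun j => φ (aGen R n ⟨i, ⟨j + 1, by omega⟩⟩)) hm (by simp [hs])
    (fun j => by rw [sideSum_succ R i (⟨j + 1, by omega⟩ : Fin (n i))])
    fun j => map_mainSum_succ φ i (⟨j + 1, by omega⟩ : Fin (n i))
  rw [Nat.sub_add_cancel hpos] at this
  rw [tail_ofFn_eq]
  exact ⟨this.1, fun h => this.2 (by omega)⟩

/-- The step (u, v) ↦ (v + a u, u) is invertible. -/
theorem map_sums_ne_zero {i : Fin k}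
    (h : φ (mainSum R n i 0) ≠ 0 ∨ φ (sideSum R n i 0) ≠ 0) {j : ℕ} (hj : j ≤ n i) :
    φ (mainSum R n i j) ≠ 0 ∨ φ (sideSum R n i j) ≠ 0 := by
  induction j with
  | zero => exact h
  | succ j ih =>
    have hm := map_mainSum_succ φ i ⟨j, hj⟩
    have hs := sideSum_succ R i ⟨j, hj⟩
    simp only at hm hs
    rw [hm, hs]
    by_cases hz : φ (mainSum R n i j) = 0
    · left
      simpa [hz] using ih (by omega)
    · exact Or.inr hz

theorem map_topSums_ne_zero {i : Fin k}
    (h : φ (topMainSum R n i 0) ≠ 0 ∨ φ (topSideSum R n i 0) ≠ 0) {j : ℕ} (hj : j ≤ n i) :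
    φ (topMainSum R n i j) ≠ 0 ∨ φ (topSideSum R n i j) ≠ 0 := by
  induction j with
  | zero => exact h
  | succ j ih =>
    have hm := topMainSum_succ R i ⟨j, hj⟩
    have hs := topSideSum_succ R i ⟨j, hj⟩
    simp only at hm hs
    rw [hm, hs, map_add, map_mul]
    by_cases hz : φ (topMainSum R n i j) = 0
    · left
      simpa [hz] using ih (by omega)
    · exact Or.inr hz

/-- A quantity that does not change within a block, in characteristic 2. -/
theorem map_wronskian [CharP F 2] (i : Fin k) {j : ℕ} (hj : j ≤ n i) :
    φ (mainSum R n i j) * φ (topSideSum R n i j) + φ (sideSum R n i j) * φ (topMainSum R n i j) =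
      φ (mainSum R n i 0) * φ (topSideSum R n i 0) +
        φ (sideSum R n i 0) * φ (topMainSum R n i 0) := by
  induction j with
  | zero => rfl
  | succ j ih =>
    rw [← ih (by omega)]
    have hm := map_mainSum_succ φ i ⟨j, hj⟩
    have hs := sideSum_succ R i ⟨j, hj⟩
    have htm := topMainSum_succ R i ⟨j, hj⟩
    have hts := topSideSum_succ R i ⟨j, hj⟩
    simp only at hm hs htm hts
    rw [hm, hs, htm, hts, map_add, map_mul]
    -- The term a · main · top main occurs twice and cancels in characteristic 2.
    linear_combination (φ (aGen R n ⟨i, ⟨j, hj⟩⟩) * φ (mainSum R n i j) * φ (topMainSum R n i j)) *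
      CharTwo.two_eq_zero (R := F)

theorem map_diskSum_odd {i : Fin k} (h : ¬ i.val % 2 = 0) {j : ℕ} (hj : j ≤ n i) :
    φ (diskSum R n (before n i j) 2 3) = φ (diskSum R n (before n i 0) 2 3) := by
  induction j with
  | zero => rfl
  | succ j ih =>
    rw [← ih (by omega)]
    exact congrArg φ (diskSum_odd_succ R h ⟨j, hj⟩)

/-- The disk sums at the beginning of a block other than the first one, if the equations for the
crossings to its left hold. -/
structure StartsWell (i : Fin k) : Prop where
  zero_two : φ (diskSum R n (before n i 0) 0 2) ≠ 0
  one_three : φ (diskSum R n (before n i 0) 1 3) ≠ 0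
  two_three : φ (diskSum R n (before n i 0) 2 3) = 0

/-- Here the Wronskian D₀₁D₁₃ + D₀₂D₂₃ is 0. At the end D₀₁ = 0, so D₀₂ ≠ 0, which forces D₂₃ = 0
and hence D₁₃ ≠ 0. The hypotheses are weaker than `StartsWell` because the first block, where D₀₁ =
D₂₃ = 1, must be included. -/
theorem StartsWell.next_even [CharP F 2] {i i' : Fin k} (hi : i.val % 2 = 0)
    (h : i'.val = i.val + 1)
    (hne : φ (mainSum R n i 0) ≠ 0 ∨ φ (sideSum R n i 0) ≠ 0)
    (htop : φ (topMainSum R n i 0) ≠ 0 ∨ φ (topSideSum R n i 0) ≠ 0)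
    (hw : φ (mainSum R n i 0) * φ (topSideSum R n i 0) +
      φ (sideSum R n i 0) * φ (topMainSum R n i 0) = 0)
    (hz : φ (mainSum R n i (n i)) = 0) : StartsWell φ i' := by
  have h₁ := (map_sums_ne_zero φ hne le_rfl).resolve_left (not_not.2 hz)
  have h₂ := map_topSums_ne_zero φ htop le_rfl
  have h₃ := map_wronskian φ i le_rfl
  rw [hw, hz, zero_mul, zero_add] at h₃
  have h₄ := (mul_eq_zero.1 h₃).resolve_left h₁
  have h₅ := h₂.resolve_left (not_not.2 h₄)
  simp only [topMainSum, topSideSum, hi, if_true] at h₄ h₅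
  constructor <;> rw [before_next i i' h]
  exacts [h₁, h₅, h₄]

/-- Here the Wronskian D₁₂D₀₃ + D₀₂D₁₃ is nonzero, and D₁₂ vanishes at both ends of the block, so
D₀₂D₁₃ stays nonzero. Strands 2, 3 do not take part in the crossings. -/
theorem StartsWell.next_odd [CharP F 2] (hn : IsRationalForm n) {i i' : Fin k}
    (hi : ¬ i.val % 2 = 0) (h : i'.val = i.val + 1) (H : StartsWell φ i)
    (hz : φ (mainSum R n i (n i)) = 0) : StartsWell φ i' := by
  have h₃ := map_wronskian φ i le_rfl
  rw [hz, mainSum_start R hn (by omega), map_zero, zero_mul, zero_mul, zero_add, zero_add] at h₃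
  have h₄ : φ (sideSum R n i 0) * φ (topMainSum R n i 0) ≠ 0 := by
    simpa only [sideSum, topMainSum, hi, if_false] using mul_ne_zero H.zero_two H.one_three
  rw [← h₃] at h₄
  simp only [sideSum, topMainSum, hi, if_false] at h₄
  constructor <;> rw [before_next i i' h]
  exacts [left_ne_zero_of_mul h₄, right_ne_zero_of_mul h₄,
    (map_diskSum_odd φ hi le_rfl).trans H.two_three]

theorem startsWell [CharP F 2] (hn : IsRationalForm n) (N : ℕ) (i : Fin k) (hi : i.val = N + 1)
    (hz : ∀ i₀ : Fin k, i₀.val < i.val → φ (mainSum R n i₀ (n i₀)) = 0) : StartsWell φ i := by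
  induction N generalizing i with
  | zero =>
    have h := first_block R (n := n) (i := ⟨0, by omega⟩) rfl
    refine StartsWell.next_even φ (i := ⟨0, by omega⟩) rfl hi ?_ ?_ ?_ (hz _ (by simp; omega)) <;>
      simp [h]
  | succ N ih =>
    obtain ⟨i₀, h⟩ := exists_prev (i := i) (by omega)
    have H := ih i₀ (by omega) fun i' hi' => hz i' (by omega)
    have hz₀ := hz i₀ (by omega)
    by_cases hp : i₀.val % 2 = 0
    · have hm := mainSum_start R hn (i := i₀) (by omega)
      have h₁ := H.zero_two
      have h₂ := H.one_three
      have h₃ := H.two_three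
      refine StartsWell.next_even φ hp h (Or.inr h₁) (Or.inr ?_) ?_ hz₀
      · simpa [topSideSum, hp] using h₂
      · simp [hm, topMainSum, hp, h₃]
    · exact StartsWell.next_odd φ hn hp h H hz₀

theorem map_mainSum_end_eq_zero (h : ∀ c : Crossing n, φ (d R n (aGen R n c)) = 0)
    (hn : IsRationalForm n) {i : Fin k} (hi : i.val + 1 < k) : φ (mainSum R n i (n i)) = 0 := by
  have := h ⟨⟨i.val + 1, hi⟩, ⟨0, hn.pos _⟩⟩
  rw [d_aGen] at this
  rwa [← (next_block R (i := i) (i' := ⟨i.val + 1, hi⟩) rfl).2.1]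

theorem startsWell_of_map_d [CharP F 2] (hn : IsRationalForm n)
    (h : ∀ c : Crossing n, φ (d R n (aGen R n c)) = 0) {i : Fin k} (hi : 0 < i.val) :
    StartsWell φ i :=
  startsWell φ hn (i.val - 1) i (by omega) fun _ hi₀ => map_mainSum_end_eq_zero φ h hn (by omega)

/-- The equation at b₁ says that the final `mainSum` takes the value of t₁, a unit. For k odd the
Wronskian is 0, so D₂₃ = 0 would also kill D₁₃, against the invertibility of the recursion. For k
even the sum is the nonzero Wronskian divided by t₁. -/
theorem map_cuspSum_one_ne_zero [CharP F 2] (hk : 2 ≤ k) (hn : IsRationalForm n)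
    (h : ∀ c : Crossing n, φ (d R n (aGen R n c)) = 0) (hb : φ (d R n (bGen R n 0)) = 0) :
    φ (cuspSum R n 1) ≠ 0 := by
  obtain ⟨i, hi⟩ : ∃ i : Fin k, i.val + 1 = k := ⟨⟨k - 1, by omega⟩, by simp; omega⟩
  have H := startsWell_of_map_d φ hn h (i := i) (by omega)
  have hm := mainSum_start R hn (i := i) (by omega)
  have hw := map_wronskian φ i le_rfl
  have ht := map_tGen_ne_zero φ 0
  have ht' := map_tInvGen φ 0
  rw [d_bGen, map_add, CharTwo.add_eq_zero] at hb
  rw [← hb] at ht ht'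
  rw [cuspSum_zero_eq R n i hi] at ht ht'
  unfold cuspSum totalSum
  rw [crossings_reverse i hi]
  by_cases hp : i.val % 2 = 0
  · have htop : φ (topMainSum R n i 0) ≠ 0 ∨ φ (topSideSum R n i 0) ≠ 0 :=
      Or.inr (by simpa [topSideSum, hp] using H.one_three)
    replace htop := map_topSums_ne_zero φ htop le_rfl
    have h23 := H.two_three
    have hz : φ (topMainSum R n i 0) = 0 := by simpa [topMainSum, hp] using h23
    rw [hm, hz, map_zero, zero_mul, mul_zero, add_zero] at hw
    rw [if_pos (by omega), if_neg (by decide)]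
    intro h0
    have h0' : φ (topMainSum R n i (n i)) = 0 := by simpa [topMainSum, hp] using h0
    rw [h0', mul_zero, add_zero] at hw
    exact (mul_ne_zero ht (htop.resolve_left (not_not.2 h0'))) hw
  · have h23 := (map_diskSum_odd φ hp le_rfl).trans H.two_three
    have h01 : diskSum R n (before n i (n i)) 0 1 = 0 := by
      simpa [crossingSum, hp] using crossingSum_end R (hn.pos i)
    have hw0 : φ (sideSum R n i 0) * φ (topMainSum R n i 0) ≠ 0 := by
      simpa only [sideSum, topMainSum, hp, if_false] using mul_ne_zero H.zero_two H.one_three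
    rw [hm, map_zero, zero_mul, zero_add] at hw
    rw [← hw] at hw0
    rw [if_neg (by omega), if_neg (by decide)]
    simp only [mainSum, sideSum, topMainSum, topSideSum, hp, if_false] at hw0 ht ht'
    intro h0
    refine hw0 ?_
    -- As D₂₃ = D₀₁ = 0, every term containing b₁ disappears and D₀₃ + D₁₃ D₁₂⁻¹ D₀₂ remains.
    simp [h23, h01, ht'] at h0
    field_simp at h0
    linear_combination h0

end Values

/-! ### Homotopies -/

section Homotopies

variable {R : Type*} [CommRing R] {F : Type*} [Field F] [Algebra R F] {k : ℕ} {n : Fin k → ℕ}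

/-- The side sum passes unchanged to the next block, where it becomes the factor s in front of the
continuants; each middle block multiplies it by the continuant without its two end crossings. -/
theorem map_sideSum_end [CharP F 2] (hn : IsRationalForm n) (ε : Augmentation R F n) (N : ℕ)
    (i : Fin k) (hN : i.val = N) (hi : i.val + 1 < k) :
    ε.1 (sideSum R n i (n i)) = homotopyFactor ε i := by
  induction N generalizing i with
  | zero =>
    have : Finset.Iic i = {i} := by
      ext l
      simp [Fin.le_def, Fin.ext_iff, hN]
    rw [homotopyFactor, this, Finset.prod_singleton, if_pos hN]
    exact (map_sums_first ε.1 hN).2 (hn.pos i)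
  | succ N ih =>
    obtain ⟨i₀, h⟩ := exists_prev (i := i) (by omega)
    have : Finset.Iic i = insert i (Finset.Iic i₀) := by
      ext l
      simp only [Finset.mem_Iic, Finset.mem_insert, Fin.le_def, Fin.ext_iff]
      omega
    rw [homotopyFactor, this, Finset.prod_insert (by simp [Fin.le_def, h]), if_neg (by omega)]
    have e := (map_sums_right ε.1 hn (i := i) (by omega)).2 (hn.two_le i (by omega) hi)
    rw [(next_block R h).2.2, ih i₀ (by omega) (by omega), homotopyFactor] at e
    rw [e, mul_comm]
    rfl

theorem homotopyFactor_ne_zero [CharP F 2] (hn : IsRationalForm n) (ε : Augmentation R F n)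
    {i : Fin k} (hi : i.val + 1 < k) : homotopyFactor ε i ≠ 0 := by
  rw [← map_sideSum_end hn ε i i rfl hi, ← (next_block R (i' := ⟨i.val + 1, hi⟩) rfl).2.2]
  exact (startsWell_of_map_d ε.1 hn (fun c => ε.2 _) (Nat.succ_pos _)).zero_two

/-- The continuants omit the first crossing of every block after the first, so no boundary crossing
enters. -/
theorem homotopyFactor_congr {ε₁ ε₂ : Augmentation R F n}
    (h : ∀ c : Crossing n, NonBoundary c → ε₁.1 (aGen R n c) = ε₂.1 (aGen R n c)) (i : Fin k) :
    homotopyFactor ε₁ i = homotopyFactor ε₂ i := by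
  refine Finset.prod_congr rfl fun l _ => ?_
  unfold blockValues
  split_ifs with hl
  · congr 3
    ext j
    exact h _ (Or.inl hl)
  · rw [tail_ofFn_eq, tail_ofFn_eq]
    congr 3
    ext j
    exact h _ (Or.inr (Nat.succ_ne_zero _))

namespace IsSkewDerivation

variable {φ ψ : LegAlg R n →ₐ[R] F} {h : LegAlg R n →ₗ[R] F}

theorem map_sums_succ (H : IsSkewDerivation φ ψ h) {i : Fin k} (j : Fin (n i))
    (ha : h (aGen R n ⟨i, j⟩) = 0) (hj : h (mainSum R n i j) = 0 ∧ h (sideSum R n i j) = 0) :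
    h (mainSum R n i (j + 1)) = 0 ∧ h (sideSum R n i (j + 1)) = 0 := by
  rw [mainSum_succ, sideSum_succ, map_add]
  split_ifs <;> simp [H _ _, hj, ha]

/-- The support of h is reached only at the last crossing of a block. What the next block inherits
is 0 and the side sum, which equals the `mainSum` before that last crossing. -/
theorem map_sums_eq_zero (H : IsSkewDerivation φ ψ h) (hn : IsRationalForm n)
    (h₀ : ∀ c : Crossing n, (c.1.val + 1 = k ∨ c.2.val + 1 ≠ n c.1) → h (aGen R n c) = 0)
    (N : ℕ) (i : Fin k) (hi : i.val = N) (j : ℕ) (hj : j < n i) :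
    h (mainSum R n i j) = 0 ∧ h (sideSum R n i j) = 0 := by
  induction N generalizing i j with
  | zero =>
    induction j with
    | zero => simp [first_block R hi, H.map_one]
    | succ j ih =>
      exact H.map_sums_succ ⟨j, by omega⟩ (h₀ ⟨i, ⟨j, by omega⟩⟩ (Or.inr hj.ne)) (ih (by omega))
  | succ N ihN =>
    obtain ⟨i₀, hi₀⟩ := exists_prev (i := i) (by omega)
    induction j with
    | zero =>
      rw [mainSum_start R hn (by omega), (next_block R hi₀).2.2]
      refine ⟨map_zero h, ?_⟩
      have hs := sideSum_succ R i₀ (⟨n i₀ - 1, by have := hn.pos i₀; omega⟩ : Fin (n i₀))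
      simp only [Nat.sub_add_cancel (hn.pos i₀)] at hs
      rw [hs]
      exact (ihN i₀ (by omega) _ (by have := hn.pos i₀; omega)).1
    | succ j ih =>
      exact H.map_sums_succ ⟨j, by omega⟩ (h₀ ⟨i, ⟨j, by omega⟩⟩ (Or.inr hj.ne)) (ih (by omega))

/-- Only the Leibniz term with h on the last crossing survives. Its coefficient is the previous
`mainSum`, that is, the final `sideSum`, evaluated at ψ or φ according to the side of the letter;
`he` makes the two agree. -/
theorem map_mainSum_end (H : IsSkewDerivation φ ψ h) (hn : IsRationalForm n)
    (h₀ : ∀ c : Crossing n, (c.1.val + 1 = k ∨ c.2.val + 1 ≠ n c.1) → h (aGen R n c) = 0)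
    (i : Fin k) (he : φ (sideSum R n i (n i)) = ψ (sideSum R n i (n i))) (j : Fin (n i))
    (hj : j.val + 1 = n i) :
    h (mainSum R n i (n i)) = φ (sideSum R n i (n i)) * h (aGen R n ⟨i, j⟩) := by
  have hz := H.map_sums_eq_zero hn h₀ i i rfl j j.2
  rw [← hj, sideSum_succ] at he ⊢
  rw [mainSum_succ, map_add, hz.2, zero_add]
  split_ifs
  · rw [H, hz.1, mul_zero, add_zero, he, mul_comm]
  · rw [H, hz.1, zero_mul, zero_add]

end IsSkewDerivation

theorem exists_explicit_homotopy [CharP F 2] (hn : IsRationalForm n)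
    (ε₁ ε₂ : Augmentation R F n)
    (hε : ∀ c : Crossing n, NonBoundary c → ε₁.1 (aGen R n c) = ε₂.1 (aGen R n c)) :
    ∃ h : LegAlg R n →ₗ[R] F, IsHomotopy ε₁ ε₂ h ∧
      (∀ j, h (bGen R n j) = 0) ∧
      (∀ c : Crossing n, (c.1.val + 1 = k ∨ c.2.val + 1 ≠ n c.1) → h (aGen R n c) = 0) ∧
      ∀ i i' : Fin k, i'.val = i.val + 1 → ∀ (j : Fin (n i)) (j' : Fin (n i')),
        j.val + 1 = n i → j'.val = 0 →
        homotopyFactor ε₁ i ≠ 0 ∧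
        h (aGen R n ⟨i, j⟩) = (homotopyFactor ε₁ i)⁻¹ *
          (ε₁.1 (aGen R n ⟨i', j'⟩) - ε₂.1 (aGen R n ⟨i', j'⟩)) := by
  let y : Crossing n → F := fun c =>
    if hc : c.1.val + 1 = k ∨ c.2.val + 1 ≠ n c.1 then 0 else
      (homotopyFactor ε₁ c.1)⁻¹ *
        (ε₁.1 (aGen R n ⟨⟨c.1.val + 1, by omega⟩, ⟨0, hn.pos _⟩⟩) -
          ε₂.1 (aGen R n ⟨⟨c.1.val + 1, by omega⟩, ⟨0, hn.pos _⟩⟩))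
  let x : ReebChord n → F
    | .a c => y c
    | .b _ => 0
  have hy : ∀ c : Crossing n, (c.1.val + 1 = k ∨ c.2.val + 1 ≠ n c.1) → y c = 0 :=
    fun c hc => dif_pos hc
  have hy' : ∀ i i' : Fin k, i'.val = i.val + 1 → ∀ (j : Fin (n i)) (j' : Fin (n i')),
      j.val + 1 = n i → j'.val = 0 → y ⟨i, j⟩ = (homotopyFactor ε₁ i)⁻¹ *
        (ε₁.1 (aGen R n ⟨i', j'⟩) - ε₂.1 (aGen R n ⟨i', j'⟩)) := by
    rintro i ⟨i', hi'⟩ h j ⟨j', hj'⟩ hj h0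
    obtain rfl : i' = i.val + 1 := h
    obtain rfl : j' = 0 := h0
    exact dif_neg (by simp only; omega)
  -- Three derivations with the same chord values: `f` yields the value s needed at t₁, `g` has this
  -- value and yields s' at t₂, and `h` has both.
  obtain ⟨f, hf, hfx, -⟩ := IsSkewDerivation.exists_of_values ε₁.1 ε₂.1 x 0
  let s := ε₁.1 (bGen R n 0) - ε₂.1 (bGen R n 0) - f (cuspSum R n 0)
  obtain ⟨g, hg, hgx, hgt⟩ := IsSkewDerivation.exists_of_values ε₁.1 ε₂.1 x ![s, 0]
  let s' := ε₁.1 (bGen R n 1) - ε₂.1 (bGen R n 1) - g (cuspSum R n 1)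
  obtain ⟨h, hh, hhx, hht⟩ := IsSkewDerivation.exists_of_values ε₁.1 ε₂.1 x ![s, s']
  have ha : ∀ c, h (aGen R n c) = y c := fun c => hhx _
  have hb : ∀ j, h (bGen R n j) = 0 := fun j => hhx _
  have h₀ : ∀ c : Crossing n, (c.1.val + 1 = k ∨ c.2.val + 1 ≠ n c.1) → h (aGen R n c) = 0 :=
    fun c hc => (ha c).trans (hy c hc)
  have hc0 : h (cuspSum R n 0) = f (cuspSum R n 0) := by
    refine hh.eqOn_adjoin hf ?_ (cuspSum_zero_mem R n)
    rintro _ ⟨c, rfl⟩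
    exact (hhx _).trans (hfx (.a c)).symm
  have hc1 : h (cuspSum R n 1) = g (cuspSum R n 1) := by
    refine hh.eqOn_adjoin hg ?_ (cuspSum_one_mem R n)
    rintro _ (⟨c, rfl⟩ | rfl | rfl)
    · exact (hhx (.a c)).trans (hgx (.a c)).symm
    · exact (hhx (.b 0)).trans (hgx (.b 0)).symm
    · rw [hh.map_tInvGen, hg.map_tInvGen, hht, hgt]
      rfl
  refine ⟨h, ⟨hh, ?_⟩, hb, h₀, ?_⟩
  · rintro (c | j)
    · change ε₁.1 (aGen R n c) - ε₂.1 (aGen R n c) = h (d R n (aGen R n c))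
      by_cases hc : NonBoundary c
      · rw [d_aGen_nonBoundary R hc, hε c hc, sub_self, map_zero]
      · obtain ⟨i', j'⟩ := c
        simp only [NonBoundary, not_or, not_not] at hc
        obtain ⟨i, hi⟩ := exists_prev (i := i') (by omega)
        have hpos := hn.pos i
        have e₁ := map_sideSum_end hn ε₁ i i rfl (by omega)
        have e₂ := map_sideSum_end hn ε₂ i i rfl (by omega)
        rw [d_aGen, hc.2, (next_block R hi).2.1, hh.map_mainSum_end hn h₀ i
          (by rw [e₁, e₂, homotopyFactor_congr hε]) ⟨n i - 1, by omega⟩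
          (Nat.sub_add_cancel hpos), ha, hy' i i' hi _ j' (Nat.sub_add_cancel hpos) hc.2, e₁,
          mul_inv_cancel_left₀ (homotopyFactor_ne_zero hn ε₁ (by omega))]
    · change ε₁.1 (bGen R n j) - ε₂.1 (bGen R n j) = h (d R n (bGen R n j))
      rw [d_bGen, map_add, hht]
      fin_cases j
      · simp [hc0, s]
      · simp [hc1, s']
  · intro i i' hi j j' hj hj'
    exact ⟨homotopyFactor_ne_zero hn ε₁ (by omega), (ha _).trans (hy' i i' hi j j' hj hj')⟩

theorem homotopic_iff [CharP F 2] (hn : IsRationalForm n)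
    (ε₁ ε₂ : Augmentation R F n) : Homotopic R F n ε₁ ε₂ ↔
      ∀ c : Crossing n, NonBoundary c → ε₁.1 (aGen R n c) = ε₂.1 (aGen R n c) := by
  constructor
  · rintro ⟨h, hh⟩ c hc
    have := hh.chord (.a c)
    change ε₁.1 (aGen R n c) - ε₂.1 (aGen R n c) = h (d R n (aGen R n c)) at this
    rw [d_aGen_nonBoundary R hc, map_zero] at this
    exact sub_eq_zero.1 this
  · intro h
    obtain ⟨g, hg, -⟩ := exists_explicit_homotopy hn ε₁ ε₂ h
    exact ⟨g, hg⟩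

end Homotopies

/-! ### Construction of augmentations -/

section Construction

variable {R : Type*} [CommRing R] {F : Type*} [Field F] [Algebra R F] {k : ℕ} {n : Fin k → ℕ}

theorem LegAlg.algHom_eqOn_adjoin {φ ψ : LegAlg R n →ₐ[R] F} {S : Set (LegAlg R n)}
    (hS : ∀ x ∈ S, φ x = ψ x) {x : LegAlg R n} (hx : x ∈ Algebra.adjoin R S) : φ x = ψ x :=
  Algebra.adjoin_le (S := AlgHom.equalizer φ ψ) hS hx

theorem map_cuspSum_zero_congr {φ ψ : LegAlg R n →ₐ[R] F}
    (ha : ∀ c, φ (aGen R n c) = ψ (aGen R n c)) : φ (cuspSum R n 0) = ψ (cuspSum R n 0) := by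
  refine LegAlg.algHom_eqOn_adjoin ?_ (cuspSum_zero_mem R n)
  rintro _ ⟨c, rfl⟩
  exact ha c

theorem map_cuspSum_one_congr {φ ψ : LegAlg R n →ₐ[R] F}
    (ha : ∀ c, φ (aGen R n c) = ψ (aGen R n c)) (hb : φ (bGen R n 0) = ψ (bGen R n 0))
    (ht : φ (tGen R n 0) = ψ (tGen R n 0)) : φ (cuspSum R n 1) = ψ (cuspSum R n 1) := by
  refine LegAlg.algHom_eqOn_adjoin ?_ (cuspSum_one_mem R n)
  rintro _ (⟨c, rfl⟩ | rfl | rfl)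
  · exact ha c
  · exact hb
  · rw [map_tInvGen, map_tInvGen, ht]

theorem map_d_aGen_congr {φ ψ : LegAlg R n →ₐ[R] F}
    (ha : ∀ c, φ (aGen R n c) = ψ (aGen R n c)) (c : Crossing n) :
    φ (d R n (aGen R n c)) = ψ (d R n (aGen R n c)) := by
  rw [aGen, d_gen, dGen, dChord]
  refine LegAlg.algHom_eqOn_adjoin ?_ (diskSum_mem_adjoin R _ _ _)
  rintro _ ⟨c, rfl⟩
  exact ha c

theorem exists_algHom_of_values (x : Crossing n → F) (w : Fin 2 → F) (t : Fin 2 → F)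
    (ht : ∀ j, t j ≠ 0) : ∃ φ : LegAlg R n →ₐ[R] F, (∀ c, φ (aGen R n c) = x c) ∧
      (∀ j, φ (bGen R n j) = w j) ∧ ∀ j, φ (tGen R n j) = t j := by
  obtain ⟨φ, h₁, h₂, -⟩ := LegAlg.exists_algHom (R := R) (n := n) (A := F)
    (fun | .a c => x c | .b j => w j) t (fun j => (t j)⁻¹) (fun j => mul_inv_cancel₀ (ht j))
    fun j => inv_mul_cancel₀ (ht j)
  exact ⟨φ, fun c => h₁ (.a c), fun j => h₁ (.b j), h₂⟩

variable [CharP F 2]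

theorem Augmentation.map_tGen (ε : Augmentation R F n) (j : Fin 2) :
    ε.1 (tGen R n j) = ε.1 (cuspSum R n j) := by
  have := ε.2 (bGen R n j)
  rw [d_bGen, map_add, CharTwo.add_eq_zero] at this
  exact this.symm

theorem Augmentation.ext_chords {ε₁ ε₂ : Augmentation R F n}
    (ha : ∀ c, ε₁.1 (aGen R n c) = ε₂.1 (aGen R n c))
    (hb : ∀ j, ε₁.1 (bGen R n j) = ε₂.1 (bGen R n j)) : ε₁ = ε₂ := by
  have h₀ : ε₁.1 (tGen R n 0) = ε₂.1 (tGen R n 0) := by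
    rw [ε₁.map_tGen, ε₂.map_tGen, map_cuspSum_zero_congr ha]
  have h₁ : ε₁.1 (tGen R n 1) = ε₂.1 (tGen R n 1) := by
    rw [ε₁.map_tGen, ε₂.map_tGen, map_cuspSum_one_congr ha (hb 0) h₀]
  refine Subtype.ext (LegAlg.algHom_ext ?_ ?_)
  · rintro (c | j)
    exacts [ha c, hb j]
  · intro j
    fin_cases j
    exacts [h₀, h₁]

/-- Only t₂ has to be changed: it is reset to the value of `cuspSum R n 1`, which is nonzero and
does not involve t₂. -/
theorem exists_augmentation_of_map_d (hk : 2 ≤ k) (hn : IsRationalForm n) (φ : LegAlg R n →ₐ[R] F)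
    (ha : ∀ c : Crossing n, φ (d R n (aGen R n c)) = 0) (hb : φ (d R n (bGen R n 0)) = 0) :
    ∃ ε : Augmentation R F n, (∀ c : Crossing n, ε.1 (aGen R n c) = φ (aGen R n c)) ∧
      (∀ j, ε.1 (bGen R n j) = φ (bGen R n j)) ∧ ε.1 (tGen R n 0) = φ (tGen R n 0) := by
  obtain ⟨ψ, h₁, h₂, h₃⟩ := exists_algHom_of_values (R := R) (n := n)
    (fun c => φ (aGen R n c)) (fun j => φ (bGen R n j)) ![φ (tGen R n 0), φ (cuspSum R n 1)] (by
      intro j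
      fin_cases j
      exacts [map_tGen_ne_zero φ 0, map_cuspSum_one_ne_zero φ hk hn ha hb])
  refine ⟨⟨ψ, map_d_eq_zero ?_⟩, h₁, h₂, h₃ 0⟩
  rintro (c | j)
  · have := (map_d_aGen_congr h₁ c).trans (ha c)
    rwa [aGen, d_gen] at this
  · rw [dChord_b, map_add]
    fin_cases j
    · rw [d_bGen, map_add] at hb
      simpa [h₃, map_cuspSum_zero_congr h₁] using hb
    · simp [h₃, map_cuspSum_one_congr h₁ (h₂ 0) (h₃ 0), CharTwo.add_self_eq_zero]

theorem Augmentation.mem_openVariety (hk : 2 ≤ k) (hn : IsRationalForm n)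
    (ε : Augmentation R F n) :
    (fun c : {c : Crossing n // NonBoundary c} => ε.1 (aGen R n c.1)) ∈ openVariety F n := by
  have hd : ∀ c : Crossing n, ε.1 (d R n (aGen R n c)) = 0 := fun c => ε.2 _
  refine ⟨fun i hi => ?_, fun i hi hi' => ?_, fun i hi => ?_⟩
  · exact (map_sums_first ε.1 hi).1.symm.trans
      (map_mainSum_end_eq_zero ε.1 hd hn (i := i) (by omega))
  · have h := (map_sums_right ε.1 hn hi).1
    rw [map_mainSum_end_eq_zero ε.1 hd hn hi', tail_ofFn_eq] at h
    exact (mul_eq_zero.1 h.symm).resolve_left (startsWell_of_map_d ε.1 hn hd hi).zero_two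
  · have h := (map_sums_right ε.1 hn (i := i) (by omega)).1
    rw [← cuspSum_zero_eq R n i hi, ← ε.map_tGen, tail_ofFn_eq] at h
    exact right_ne_zero_of_mul (h ▸ map_tGen_ne_zero ε.1 0)

theorem map_mainSum_of_mem (hn : IsRationalForm n) {φ : LegAlg R n →ₐ[R] F}
    (h : (fun c : {c : Crossing n // NonBoundary c} => φ (aGen R n c.1)) ∈ openVariety F n)
    {i : Fin k} (hi : i.val + 1 < k) : φ (mainSum R n i (n i)) = 0 := by
  rcases Nat.eq_zero_or_pos i.val with h0 | h0
  · rw [(map_sums_first φ h0).1]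
    exact h.1 i h0
  · rw [(map_sums_right φ hn h0).1, tail_ofFn_eq]
    exact mul_eq_zero_of_right _ (h.2.1 i h0 hi)

theorem map_d_aGen_of_mem (hn : IsRationalForm n) {φ : LegAlg R n →ₐ[R] F}
    (h : (fun c : {c : Crossing n // NonBoundary c} => φ (aGen R n c.1)) ∈ openVariety F n)
    (c : Crossing n) : φ (d R n (aGen R n c)) = 0 := by
  by_cases hc : NonBoundary c
  · rw [d_aGen_nonBoundary R hc, map_zero]
  · simp only [NonBoundary, not_or, not_not] at hc
    obtain ⟨i, hi⟩ := exists_prev (i := c.1) (by omega)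
    rw [d_aGen, hc.2, (next_block R hi).2.1]
    exact map_mainSum_of_mem hn h (by omega)

theorem map_cuspSum_zero_of_mem (hk : 2 ≤ k) (hn : IsRationalForm n) {φ : LegAlg R n →ₐ[R] F}
    (h : (fun c : {c : Crossing n // NonBoundary c} => φ (aGen R n c.1)) ∈ openVariety F n) :
    φ (cuspSum R n 0) ≠ 0 := by
  obtain ⟨i, hi⟩ : ∃ i : Fin k, i.val + 1 = k := ⟨⟨k - 1, by omega⟩, by simp; omega⟩
  rw [cuspSum_zero_eq R n i hi, (map_sums_right φ hn (by omega)).1, tail_ofFn_eq]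
  exact mul_ne_zero
    (startsWell_of_map_d φ hn (map_d_aGen_of_mem hn h) (i := i) (by omega)).zero_two (h.2.2 i hi)

theorem existsUnique_augmentation (hk : 2 ≤ k) (hn : IsRationalForm n) (x : openVariety F n)
    (v : {c : Crossing n // ¬ NonBoundary c} → F) (w : Fin 2 → F) :
    ∃! ε : Augmentation R F n, (∀ c, ε.1 (aGen R n c.1) = x.1 c) ∧
      (∀ c, ε.1 (aGen R n c.1) = v c) ∧ ∀ j, ε.1 (bGen R n j) = w j := by
  classical
  let y : Crossing n → F := fun c => if hc : NonBoundary c then x.1 ⟨c, hc⟩ else v ⟨c, hc⟩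
  have hy : ∀ c : {c : Crossing n // NonBoundary c}, y c.1 = x.1 c := fun c => dif_pos c.2
  have hy' : ∀ c : {c : Crossing n // ¬ NonBoundary c}, y c.1 = v c := fun c => dif_neg c.2
  have hmem {φ : LegAlg R n →ₐ[R] F} (h : ∀ c, φ (aGen R n c) = y c) :
      (fun c : {c : Crossing n // NonBoundary c} => φ (aGen R n c.1)) ∈ openVariety F n := by
    convert x.2 using 1
    ext c
    rw [h, hy]
  obtain ⟨φ, h₁, -⟩ := exists_algHom_of_values (R := R) y w 1 fun _ => one_ne_zero
  obtain ⟨ψ, h₁', h₂', h₃'⟩ := exists_algHom_of_values (R := R) y w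
    (fun _ => φ (cuspSum R n 0)) fun _ => map_cuspSum_zero_of_mem hk hn (hmem h₁)
  obtain ⟨ε, e₁, e₂, -⟩ := exists_augmentation_of_map_d hk hn ψ (map_d_aGen_of_mem hn (hmem h₁'))
    (by
      rw [d_bGen, map_add, h₃', map_cuspSum_zero_congr fun c => (h₁' c).trans (h₁ c).symm,
        CharTwo.add_self_eq_zero])
  refine ⟨ε, ⟨fun c => ?_, fun c => ?_, fun j => ?_⟩, ?_⟩
  · rw [e₁, h₁', hy]
  · rw [e₁, h₁', hy']
  · rw [e₂, h₂']
  · rintro ε' ⟨h₁, h₂, h₃⟩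
    refine Augmentation.ext_chords (fun c => ?_) fun j => by rw [h₃, e₂, h₂']
    rw [e₁, h₁']
    by_cases hc : NonBoundary c
    · exact (h₁ ⟨c, hc⟩).trans (hy ⟨c, hc⟩).symm
    · exact (h₂ ⟨c, hc⟩).trans (hy' ⟨c, hc⟩).symm

theorem last_chord_redundant (hk : 2 ≤ k) (hn : IsRationalForm n)
    (φ : LegAlg R n →ₐ[R] F) (ha : ∀ c : Crossing n, φ (d R n (aGen R n c)) = 0)
    (hb : φ (d R n (bGen R n 0)) = 0) :
    φ (d R n (bGen R n 1) + tGen R n 1) ≠ 0 ∧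
      ∃! ε : Augmentation R F n, (∀ c : Crossing n, ε.1 (aGen R n c) = φ (aGen R n c)) ∧
        (∀ j, ε.1 (bGen R n j) = φ (bGen R n j)) ∧ ε.1 (tGen R n 0) = φ (tGen R n 0) := by
  constructor
  · rw [d_bGen, map_add, map_add, CharTwo.add_cancel_right]
    exact map_cuspSum_one_ne_zero φ hk hn ha hb
  · obtain ⟨ε, h⟩ := exists_augmentation_of_map_d hk hn φ ha hb
    exact ⟨ε, h, fun ε' h' => Augmentation.ext_chords
      (fun c => (h'.1 c).trans (h.1 c).symm) fun j => (h'.2.1 j).trans (h.2.1 j).symm⟩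

end Construction

/-! ### Regular functions -/

section Regular

variable {F : Type*} [Field F] {X σ : Type*} {coord : X → σ → F}

namespace IsRegularFun

theorem coordinate (i : σ) : IsRegularFun coord fun x => coord x i :=
  fun _ => ⟨MvPolynomial.X i, 1, by simp, by simp⟩

theorem const (a : F) : IsRegularFun coord fun _ => a :=
  fun _ => ⟨MvPolynomial.C a, 1, by simp, by simp⟩

variable {f g : X → F}

theorem add (hf : IsRegularFun coord f) (hg : IsRegularFun coord g) :
    IsRegularFun coord fun x => f x + g x := by
  intro x
  obtain ⟨p, q, hq, h⟩ := hf x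
  obtain ⟨p', q', hq', h'⟩ := hg x
  refine ⟨p * q' + q * p', q * q', by simp [hq, hq'], fun y hy => ?_⟩
  rw [map_mul] at hy
  have h₁ := left_ne_zero_of_mul hy
  have h₂ := right_ne_zero_of_mul hy
  simp only [h y h₁, h' y h₂]
  rw [div_add_div _ _ h₁ h₂]
  simp

theorem mul (hf : IsRegularFun coord f) (hg : IsRegularFun coord g) :
    IsRegularFun coord fun x => f x * g x := by
  intro x
  obtain ⟨p, q, hq, h⟩ := hf x
  obtain ⟨p', q', hq', h'⟩ := hg x
  refine ⟨p * p', q * q', by simp [hq, hq'], fun y hy => ?_⟩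
  rw [map_mul] at hy
  simp only [h y (left_ne_zero_of_mul hy), h' y (right_ne_zero_of_mul hy), map_mul]
  rw [div_mul_div_comm]

theorem sub (hf : IsRegularFun coord f) (hg : IsRegularFun coord g) :
    IsRegularFun coord fun x => f x - g x := by
  simpa [sub_eq_add_neg] using hf.add ((const (-1)).mul hg)

/-- A function that is locally the quotient of two regular functions is regular. -/
theorem of_div (h : ∀ x, ∃ g₁ g₂ : X → F, IsRegularFun coord g₁ ∧ IsRegularFun coord g₂ ∧
    g₂ x ≠ 0 ∧ ∀ y, g₂ y ≠ 0 → f y = g₁ y / g₂ y) : IsRegularFun coord f := by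
  intro x
  obtain ⟨g₁, g₂, h₁, h₂, hx, hf⟩ := h x
  obtain ⟨p, q, hq, h⟩ := h₁ x
  obtain ⟨p', q', hq', h'⟩ := h₂ x
  have hp' : MvPolynomial.eval (coord x) p' ≠ 0 := by
    rw [h' x hq'] at hx
    exact (div_ne_zero_iff.1 hx).1
  -- The extra factor q' ensures that q' is nonzero wherever the new denominator is, so that the
  -- local formula for `g₂` applies there.
  refine ⟨p * q' * q', q * p' * q', by simp [hq, hp', hq'], fun y hy => ?_⟩
  simp only [map_mul, mul_ne_zero_iff] at hy
  obtain ⟨⟨h₁, h₂⟩, h₃⟩ := hy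
  have hg : g₂ y ≠ 0 := by
    rw [h' y h₃]
    exact div_ne_zero h₂ h₃
  rw [hf y hg, h y h₁, h' y h₃]
  simp only [map_mul]
  field_simp

theorem inv (hf : IsRegularFun coord f) (h : ∀ x, f x ≠ 0) :
    IsRegularFun coord fun x => (f x)⁻¹ :=
  of_div fun x => ⟨_, f, const 1, hf, h x, fun y _ => by rw [one_div]⟩

theorem comp {Y τ : Type*} {coord' : Y → τ → F} {s : X → Y} {f : Y → F}
    (hf : IsRegularFun coord' f) (hs : ∀ i, IsRegularFun coord fun x => coord' (s x) i) :
    IsRegularFun coord fun x => f (s x) := by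
  have hp (p : MvPolynomial τ F) :
      IsRegularFun coord fun x => MvPolynomial.eval (coord' (s x)) p := by
    induction p using MvPolynomial.induction_on with
    | C a => simpa using const a
    | add p q hp hq => simpa using hp.add hq
    | mul_X p i hp => simpa using hp.mul (hs i)
  refine of_div fun x => ?_
  obtain ⟨p, q, hq, h⟩ := hf (s x)
  exact ⟨_, _, hp p, hp q, hq, fun y hy => h _ hy⟩

/-- A regular section recovers a function from its pull-back: f = (f ∘ e) ∘ s. -/
theorem iff_comp {Y τ : Type*} {coord' : Y → τ → F} {e : X → Y} {s : Y → X} (hes : ∀ y, e (s y) = y)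
    (he : ∀ i, IsRegularFun coord fun x => coord' (e x) i)
    (hs : ∀ i, IsRegularFun coord' fun y => coord (s y) i) (f : Y → F) :
    IsRegularFun coord' f ↔ IsRegularFun coord fun x => f (e x) := by
  refine ⟨fun h => h.comp he, fun h => ?_⟩
  simpa only [hes] using h.comp hs

theorem continuant_map {l : List (X → F)} (hl : ∀ f ∈ l, IsRegularFun coord f) :
    IsRegularFun coord fun x => continuant (l.map fun f => f x) := by
  induction l using continuant.induct with
  | case1 => exact const 1
  | case2 f => exact hl f (by simp)
  | case3 f g l ih₁ ih₂ =>
    refine ((hl f (by simp)).mul (ih₁ fun e he => hl e ?_)).sub (ih₂ fun e he => hl e ?_)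
    exacts [List.mem_cons_of_mem _ he, List.mem_cons_of_mem _ (List.mem_cons_of_mem _ he)]

theorem algHom_of_mem_adjoin {R A : Type*} [CommRing R] [Ring A] [Algebra R A] [Algebra R F]
    {φ : X → A →ₐ[R] F} {S : Set A} (hS : ∀ a ∈ S, IsRegularFun coord fun x => φ x a) {a : A}
    (ha : a ∈ Algebra.adjoin R S) : IsRegularFun coord fun x => φ x a := by
  induction ha using Algebra.adjoin_induction with
  | mem a ha => exact hS a ha
  | algebraMap r => simpa using const _
  | add a b _ _ ha hb => simpa using ha.add hb
  | mul a b _ _ ha hb => simpa using ha.mul hb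

end IsRegularFun

/-- The chords determine t₁, then its nowhere vanishing value can be inverted, and t₂ is a
polynomial in the crossings, b₁ and t₁⁻¹. -/
theorem isRegularFun_coord {R : Type*} [CommRing R] [Algebra R F] [CharP F 2] {k : ℕ}
    {n : Fin k → ℕ} {ε : X → Augmentation R F n}
    (ha : ∀ c, IsRegularFun coord fun x => (ε x).1 (aGen R n c))
    (hb : ∀ j, IsRegularFun coord fun x => (ε x).1 (bGen R n j)) (g : Gen n) :
    IsRegularFun coord fun x => (ε x).coord g := by
  have hinv {j} (h : IsRegularFun coord fun x => (ε x).1 (tGen R n j)) :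
      IsRegularFun coord fun x => (ε x).1 (tInvGen R n j) := by
    simpa only [map_tInvGen] using h.inv fun x => map_tGen_ne_zero _ _
  have h₀ : IsRegularFun coord fun x => (ε x).1 (tGen R n 0) := by
    simp only [Augmentation.map_tGen]
    refine IsRegularFun.algHom_of_mem_adjoin (φ := fun x => (ε x).1) ?_ (cuspSum_zero_mem R n)
    rintro _ ⟨c, rfl⟩
    exact ha c
  have h₁ : IsRegularFun coord fun x => (ε x).1 (tGen R n 1) := by
    simp only [Augmentation.map_tGen]
    refine IsRegularFun.algHom_of_mem_adjoin (φ := fun x => (ε x).1) ?_ (cuspSum_one_mem R n)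
    rintro _ (⟨c, rfl⟩ | rfl | rfl)
    exacts [ha c, hb 0, hinv h₀]
  have ht : ∀ j, IsRegularFun coord fun x => (ε x).1 (tGen R n j) := by
    intro j
    fin_cases j
    exacts [h₀, h₁]
  rcases g with (c | j) | j | j
  exacts [ha c, hb j, ht j, hinv (ht j)]

end Regular

/-! ### The two varieties -/

section LastBlock

variable {α : Type*} {k : ℕ} {n : Fin k → ℕ}

theorem ofFn_eq_cons {m : ℕ} (hm : 1 ≤ m) (f : Fin m → α) :
    List.ofFn f = f ⟨0, hm⟩ :: List.ofFn fun j : Fin (m - 1) => f ⟨j + 1, by omega⟩ := by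
  obtain ⟨m, rfl⟩ := Nat.exists_eq_add_of_le' hm
  rw [List.ofFn_succ]
  rfl

/-- The variables of the last block without the boundary crossing. -/
def lastRightBlock (i : Fin k) (x : {c : Crossing n // NonBoundary c} → α) : List α :=
  rightBlock x i fun _ hj => Or.inr hj

/-- The projection that forgets the boundary crossing of the last block. -/
def restrictPoint (x : {c : Crossing n // NonBoundary' c} → α) :
    {c : Crossing n // NonBoundary c} → α := fun c => x ⟨c.1, Or.inl c.2⟩

theorem block_last {i : Fin k} (hi : i.val + 1 = k) (hn : 1 ≤ n i)
    (x : {c : Crossing n // NonBoundary' c} → α) :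
    block x i (fun _ => Or.inr hi) =
      x ⟨⟨i, ⟨0, hn⟩⟩, Or.inr hi⟩ :: lastRightBlock i (restrictPoint x) :=
  ofFn_eq_cons hn _

end LastBlock

section ClosedVariety

variable {F : Type*} [Field F] {k : ℕ} {n : Fin k → ℕ}

/-- The continuant of a list without its first entry; it is `0` for the empty list. -/
def tailContinuant (l : List F) : F := if l = [] then 0 else continuant l.tail

theorem continuant_cons (a : F) (l : List F) :
    continuant (a :: l) = a * continuant l - tailContinuant l := by
  cases l <;> simp [continuant, tailContinuant]

/-- If two consecutive continuants vanished, so would the next shorter one, and finally K₀ = 1. -/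
theorem continuant_ne_zero_of_cons {a : F} {l : List F} (h : continuant (a :: l) = 0) :
    continuant l ≠ 0 := by
  induction l generalizing a with
  | nil => simp [continuant]
  | cons b l ih =>
    intro h'
    refine ih h' ?_
    simpa [continuant, h'] using h

open Classical in
/-- The extension of a point of the open variety to the boundary crossing of the last block `i`. -/
noncomputable def extendPoint (i : Fin k) (x : {c : Crossing n // NonBoundary c} → F) :
    {c : Crossing n // NonBoundary' c} → F := fun c =>
  if hc : NonBoundary c.1 then x ⟨c.1, hc⟩
  else tailContinuant (lastRightBlock i x) / continuant (lastRightBlock i x)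

theorem restrictPoint_extendPoint (i : Fin k) (x : {c : Crossing n // NonBoundary c} → F) :
    restrictPoint (extendPoint i x) = x := by
  ext c
  exact dif_pos c.2

theorem not_nonBoundary_iff (hk : 2 ≤ k) {i : Fin k} (hi : i.val + 1 = k) (hn : 1 ≤ n i)
    (c : {c : Crossing n // NonBoundary' c}) :
    ¬ NonBoundary c.1 ↔ c = ⟨⟨i, ⟨0, hn⟩⟩, Or.inr hi⟩ := by
  obtain ⟨⟨i', j, hj⟩, hc⟩ := c
  constructor
  · intro h
    have hi' := hc.resolve_left h
    simp only [NonBoundary, not_or, not_not] at h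
    obtain rfl : i' = i := by
      ext
      simp only at hi'
      omega
    obtain rfl : j = 0 := h.2
    rfl
  · intro h
    cases h
    simp only [NonBoundary, not_or, not_not, and_true]
    omega

theorem extendPoint_last (hk : 2 ≤ k) {i : Fin k} (hi : i.val + 1 = k) (hn : 1 ≤ n i)
    (x : {c : Crossing n // NonBoundary c} → F) :
    extendPoint i x ⟨⟨i, ⟨0, hn⟩⟩, Or.inr hi⟩ =
      tailContinuant (lastRightBlock i x) / continuant (lastRightBlock i x) :=
  dif_neg ((not_nonBoundary_iff hk hi hn _).2 rfl)

variable (F) in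
/-- The open variety is the closed one: the additional coordinate is determined by the others. -/
noncomputable def openEquivClosed (hk : 2 ≤ k) (hn : IsRationalForm n) (i : Fin k)
    (hi : i.val + 1 = k) : openVariety F n ≃ closedVariety F n where
  toFun x := ⟨extendPoint i x.1, by
    have hx := x.2
    -- The equations of the blocks before the last then hold for the extended point by definition.
    rw [← restrictPoint_extendPoint i x.1] at hx
    refine ⟨hx.1, hx.2.1, fun i' hi' => ?_⟩
    obtain rfl : i' = i := by omega
    have hne : continuant (lastRightBlock i' x.1) ≠ 0 := x.2.2.2 i' hi
    rw [block_last hi (hn.pos i'), restrictPoint_extendPoint, continuant_cons,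
      extendPoint_last hk hi, div_mul_cancel₀ _ hne, sub_self]⟩
  invFun x := ⟨restrictPoint x.1, x.2.1, x.2.2.1, fun i' hi' => by
    have h := x.2.2.2 i' hi'
    rw [block_last hi' (hn.pos i')] at h
    exact continuant_ne_zero_of_cons h⟩
  left_inv x := Subtype.ext (restrictPoint_extendPoint i x.1)
  right_inv x := by
    ext c
    by_cases hc : NonBoundary c.1
    · exact dif_pos hc
    · rw [not_nonBoundary_iff hk hi (hn.pos i)] at hc
      subst hc
      have h := x.2.2.2 i hi
      rw [block_last hi (hn.pos i)] at h
      have hne := continuant_ne_zero_of_cons h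
      rw [continuant_cons, sub_eq_zero] at h
      simp only
      rw [extendPoint_last hk hi, ← h, mul_div_cancel_right₀ _ hne]

theorem isRegularFun_extendPoint (hk : 2 ≤ k) (hn : IsRationalForm n) (i : Fin k)
    (hi : i.val + 1 = k) (c : {c : Crossing n // NonBoundary' c}) :
    IsRegularFun (fun x : openVariety F n => x.1)
      fun x => (openEquivClosed F hk hn i hi x).1 c := by
  by_cases hc : NonBoundary c.1
  · simpa only [openEquivClosed, Equiv.coe_fn_mk, extendPoint, hc, dif_pos] using
      IsRegularFun.coordinate (coord := fun x : openVariety F n => x.1) ⟨c.1, hc⟩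
  · rw [not_nonBoundary_iff hk hi (hn.pos i)] at hc
    subst hc
    simp only [openEquivClosed, Equiv.coe_fn_mk, extendPoint_last hk hi, div_eq_mul_inv]
    -- The variables form one list of coordinate functions, independent of the point, as
    -- `IsRegularFun.continuant_map` requires.
    let l : List (openVariety F n → F) := List.ofFn fun (j : Fin (n i - 1)) x =>
      x.1 ⟨⟨i, ⟨j.val + 1, by omega⟩⟩, Or.inr (Nat.succ_ne_zero _)⟩
    have hl : ∀ f ∈ l, IsRegularFun (fun x : openVariety F n => x.1) f := by
      intro f hf
      obtain ⟨j, rfl⟩ := (List.mem_ofFn' _ _).1 hf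
      exact IsRegularFun.coordinate (coord := fun x : openVariety F n => x.1) _
    have e (x : openVariety F n) : lastRightBlock i x.1 = l.map fun f => f x := by
      rw [List.map_ofFn]
      rfl
    refine IsRegularFun.mul ?_ (IsRegularFun.inv ?_ fun x => x.2.2.2 i hi)
    · simp only [e, tailContinuant, List.map_eq_nil_iff]
      split_ifs
      · exact IsRegularFun.const 0
      · simp only [← List.map_tail]
        exact IsRegularFun.continuant_map fun f hf => hl f (List.mem_of_mem_tail hf)
    · simp only [e]
      exact IsRegularFun.continuant_map hl

end ClosedVariety

/-! ### The moduli space as a variety, and its regular section -/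

section Moduli

variable (R : Type*) [CommRing R] (F : Type*) [Field F] [CharP F 2] [Algebra R F] {k : ℕ}
  {n : Fin k → ℕ}

/-- Evaluation on the non-boundary crossings. -/
noncomputable def moduliEquiv (hk : 2 ≤ k) (hn : IsRationalForm n) :
    AugModuli R F n ≃ openVariety F n :=
  Equiv.ofBijective
    (Quot.lift (fun ε => ⟨fun c => ε.1 (aGen R n c.1), ε.mem_openVariety hk hn⟩) fun ε₁ ε₂ h =>
      Subtype.ext (funext fun c => (homotopic_iff hn ε₁ ε₂).1 h c.1 c.2)) (by
    constructor
    · rintro ⟨ε₁⟩ ⟨ε₂⟩ h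
      refine Quot.sound ((homotopic_iff hn ε₁ ε₂).2 fun c hc => ?_)
      exact congrFun (congrArg Subtype.val h) ⟨c, hc⟩
    · intro x
      obtain ⟨ε, h, -⟩ := existsUnique_augmentation (R := R) hk hn x 0 0
      exact ⟨AugModuli.mk ε, Subtype.ext (funext h.1)⟩)

/-- All boundary crossings and b₁, b₂ are set to 0. -/
theorem exists_regular_section (hk : 2 ≤ k) (hn : IsRationalForm n) :
    ∃ s : openVariety F n → Augmentation R F n,
      (∀ x, moduliEquiv R F hk hn (AugModuli.mk (s x)) = x) ∧
      ∀ g, IsRegularFun (fun x : openVariety F n => x.1) fun x => (s x).coord g := by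
  choose s hs _ using fun x : openVariety F n => existsUnique_augmentation (R := R) hk hn x 0 0
  refine ⟨s, fun x => Subtype.ext (funext (hs x).1), isRegularFun_coord (fun c => ?_) fun j => ?_⟩
  · by_cases hc : NonBoundary c
    · simp only [fun x => (hs x).1 ⟨c, hc⟩]
      exact IsRegularFun.coordinate (coord := fun x : openVariety F n => x.1) _
    · simp only [fun x => (hs x).2.1 ⟨c, hc⟩]
      exact IsRegularFun.const _
  · simp only [fun x => (hs x).2.2 j]
    exact IsRegularFun.const _

theorem isRegularFun_moduliEquiv (hk : 2 ≤ k) (hn : IsRationalForm n)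
    (c : {c : Crossing n // NonBoundary c}) :
    IsRegularFun Augmentation.coord
      fun ε : Augmentation R F n => (moduliEquiv R F hk hn (AugModuli.mk ε)).1 c :=
  IsRegularFun.coordinate (coord := Augmentation.coord) (Gen.chord (ReebChord.a c.1))

end Moduli

end TwoBridge

open TwoBridge
theorem mainTheorem6 {k : ℕ} (hk : 2 ≤ k) (n : Fin k → ℕ) (hn : IsRationalForm n)
    (R : Type*) [CommRing R] [CharP R 2]
    (F : Type*) [Field F] [IsAlgClosed F] [CharP F 2] [Algebra R F] :
    -- homotopy is an equivalence relation, detected by the non-boundary crossings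
    Equivalence (Homotopic R F n) ∧
    (∀ ε₁ ε₂ : Augmentation R F n, Homotopic R F n ε₁ ε₂ ↔
      ∀ c : Crossing n, NonBoundary c → ε₁.1 (aGen R n c) = ε₂.1 (aGen R n c)) ∧
    -- identification with the variety with the inequality
    (∃ Φ : AugModuli R F n ≃ openVariety F n,
      (∀ (ε : Augmentation R F n) (c : {c : Crossing n // NonBoundary c}),
        (Φ (AugModuli.mk ε)).1 c = ε.1 (aGen R n c.1)) ∧
      ∀ f : openVariety F n → F,
        IsRegularFun (fun x : openVariety F n => x.1) f ↔
          IsRegularFun Augmentation.coord (fun ε : Augmentation R F n => f (Φ (AugModuli.mk ε)))) ∧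
    -- identification with the closed variety with one extra variable
    (∃ Ψ : AugModuli R F n ≃ closedVariety F n,
      (∀ (ε : Augmentation R F n) (c : Crossing n) (hc : NonBoundary c),
        (Ψ (AugModuli.mk ε)).1 ⟨c, Or.inl hc⟩ = ε.1 (aGen R n c)) ∧
      ∀ f : closedVariety F n → F,
        IsRegularFun (fun x : closedVariety F n => x.1) f ↔
          IsRegularFun Augmentation.coord (fun ε : Augmentation R F n => f (Ψ (AugModuli.mk ε)))) ∧
    -- the equation of the last chord is redundant
    (∀ ε : LegAlg R n →ₐ[R] F, (∀ c : Crossing n, ε (d R n (aGen R n c)) = 0) →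
      ε (d R n (bGen R n 0)) = 0 →
      ε (d R n (bGen R n 1) + tGen R n 1) ≠ 0 ∧
      ∃! ε' : Augmentation R F n, (∀ c : Crossing n, ε'.1 (aGen R n c) = ε (aGen R n c)) ∧
        (∀ j, ε'.1 (bGen R n j) = ε (bGen R n j)) ∧ ε'.1 (tGen R n 0) = ε (tGen R n 0)) ∧
    -- the values on the remaining chords are free
    (∀ x : openVariety F n, ∀ v : {c : Crossing n // ¬ NonBoundary c} → F, ∀ w : Fin 2 → F,
      ∃! ε : Augmentation R F n, (∀ c, ε.1 (aGen R n c.1) = x.1 c) ∧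
        (∀ c, ε.1 (aGen R n c.1) = v c) ∧ ∀ j, ε.1 (bGen R n j) = w j) ∧
    -- and they are killed by explicit homotopies
    (∀ ε₁ ε₂ : Augmentation R F n,
      (∀ c : Crossing n, NonBoundary c → ε₁.1 (aGen R n c) = ε₂.1 (aGen R n c)) →
      ∃ h : LegAlg R n →ₗ[R] F, IsHomotopy ε₁ ε₂ h ∧
        (∀ j, h (bGen R n j) = 0) ∧
        (∀ c : Crossing n, (c.1.val + 1 = k ∨ c.2.val + 1 ≠ n c.1) → h (aGen R n c) = 0) ∧
        ∀ i i' : Fin k, i'.val = i.val + 1 → ∀ (j : Fin (n i)) (j' : Fin (n i')),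
          j.val + 1 = n i → j'.val = 0 →
          homotopyFactor ε₁ i ≠ 0 ∧
          h (aGen R n ⟨i, j⟩) = (homotopyFactor ε₁ i)⁻¹ *
            (ε₁.1 (aGen R n ⟨i', j'⟩) - ε₂.1 (aGen R n ⟨i', j'⟩))) := by
  have hreg := isRegularFun_moduliEquiv R F hk hn
  obtain ⟨s, hs, hsreg⟩ := exists_regular_section R F hk hn
  obtain ⟨i, hi⟩ : ∃ i : Fin k, i.val + 1 = k := ⟨⟨k - 1, by omega⟩, by simp; omega⟩
  refine ⟨⟨fun ε => ?_, fun {ε₁ ε₂} h => ?_, fun {ε₁ ε₂ ε₃} h h' => ?_⟩, homotopic_iff hn,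
    ⟨moduliEquiv R F hk hn, fun ε c => rfl, IsRegularFun.iff_comp hs hreg hsreg⟩,
    ⟨(moduliEquiv R F hk hn).trans (openEquivClosed F hk hn i hi), fun ε c hc => dif_pos hc,
      fun f => IsRegularFun.iff_comp
        (e := fun ε => openEquivClosed F hk hn i hi (moduliEquiv R F hk hn (AugModuli.mk ε)))
        (s := fun x => s ((openEquivClosed F hk hn i hi).symm x))
        (fun x => by simp only [hs, Equiv.apply_symm_apply])
        (fun c => (isRegularFun_extendPoint hk hn i hi c).comp hreg)
        (fun g => (hsreg g).comp fun c =>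
          IsRegularFun.coordinate (coord := fun x : closedVariety F n => x.1) _) f⟩,
    last_chord_redundant hk hn, existsUnique_augmentation hk hn, exists_explicit_homotopy hn⟩
  · exact (homotopic_iff hn _ _).2 fun _ _ => rfl
  · rw [homotopic_iff hn] at h ⊢
    exact fun c hc => (h c hc).symm
  · rw [homotopic_iff hn] at h h' ⊢
    exact fun c hc => (h c hc).trans (h' c hc)
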